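/- Conventions. For a group $L$, $|L|\in\mathbb{N}\cup\{\infty\}$ is its order and $\operatorname{rank}(L)\in\mathbb{N}\cup\{\infty\}$ is the least cardinality of a generating set of $L$. If $L$ is free, its reduced rank is $\bar{\mathrm r}(L)=\max\{\operatorname{rank}(L)-1,0\}\in[0,\infty]$. For a group $G$, let $\alpha(G)=\inf\{|L| : L\le G,\ |L|\ge 3\}\in[3,\infty]$ (with $\inf\emptyset=\infty$), and let $\theta(G)=\frac{\alpha(G)}{\alpha(G)-2}\in[1,3]$, where $\frac{\infty}{\infty-2}:=1$. For $H\le G$ and $s\in G$, $H^s=s^{-1}Hs$. Theorem. Let $(G_i)_{i\in I}$ be a family of groups, let $F$ be a free group, and let $G=F*\mathop{\ast}_{i\in I}G_i$ be the free product of $F$ and all the $G_i$. Let $\mathcal F$ be the set of all finitely generated subgroups $H$ of $G$ such that $H\cap G_i^{\,g}=\{1\}$ for all $g\in G$ and all $i\in I$ (every such $H$ is a free group). Let $H,K\in\mathcal F$, and let $S\subseteq G$ be a set of $(H,K)$-double coset representatives in $G$, that is, every double coset $HgK$ with $g\in G$ contains exactly one element of $S$. Then, in $[0,\infty]$, $$\sum_{s\in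 S}\bar{\mathrm r}(H^s\cap K)\ \le\ 2\cdot\theta(G)\cdot\bar{\mathrm r}(H)\cdot\bar{\mathrm r}(K).$$ -/

import Mathlib

open scoped ENNReal

noncomputable section

namespace FreeProductRank

/-- The rank of a group: the least cardinality of a generating set, an element of `ℕ ∪ {∞}`. -/
def rank (G : Type*) [Group G] : ℕ∞ :=
  ⨅ (S : Set G) (_ : Subgroup.closure S = ⊤), S.encard

/-- The reduced rank `max (rank G - 1) 0`, in `[0,∞]`; it is used for free groups. Subtraction
in `ℕ∞` is truncated at `0`, and `⊤ - 1 = ⊤`. -/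
def reducedRank (G : Type*) [Group G] : ℝ≥0∞ :=
  ((rank G - 1 : ℕ∞) : ℝ≥0∞)

/-- The infimum of the orders of the subgroups of `G` with at least three elements; it is `⊤`
if there are none. An infinite subgroup has order `⊤`. -/
def height (G : Type*) [Group G] : ℕ∞ :=
  ⨅ (L : Subgroup G) (_ : 3 ≤ (L : Set G).encard), (L : Set G).encard

/-- The function `x ↦ x / (x - 2)` on `[3,∞]`, with value `1` at `∞`. -/
def theta (x : ℕ∞) : ℝ≥0∞ :=
  if x = ⊤ then 1 else (x : ℝ≥0∞) / ((x : ℝ≥0∞) - 2)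

/-- The conjugate `H ^ g = g⁻¹ H g`. -/
def conjSubgroup {G : Type*} [Group G] (H : Subgroup G) (g : G) : Subgroup G :=
  H.map (MulAut.conj g⁻¹).toMonoidHom

/-- `S` is a set of `(H, K)`-double coset representatives in `G`: every double coset `H g K`
contains exactly one element of `S`. -/
def IsDoubleCosetReps {G : Type*} [Group G] (H K : Subgroup G) (S : Set G) : Prop :=
  ∀ g : G, ∃! s : G, s ∈ S ∧ s ∈ DoubleCoset.doubleCoset g (H : Set G) (K : Set G)

/-- The free product of a group `F` and of a family of groups `A i`. -/
abbrev FreeProd {I : Type*} (F : Type*) [Group F] (A : I → Type*) [∀ i, Group (A i)] : Type _ :=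
  Monoid.Coprod F (Monoid.CoprodI A)

/-- The free factor `A i`, as a subgroup of the free product. -/
def factor {I : Type*} (F : Type*) [Group F] (A : I → Type*) [∀ i, Group (A i)] (i : I) :
    Subgroup (FreeProd F A) :=
  ((Monoid.Coprod.inr : Monoid.CoprodI A →* FreeProd F A).comp
    (Monoid.CoprodI.of : A i →* Monoid.CoprodI A)).range

/-- The finitely generated subgroups of the free product that meet every conjugate of every
factor `A i` trivially. -/
def freeFamily {I : Type*} (F : Type*) [Group F] (A : I → Type*) [∀ i, Group (A i)] :
    Set (Subgroup (FreeProd F A)) :=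
  {H | H.FG ∧ ∀ (g : FreeProd F A) (i : I), H ⊓ conjSubgroup (factor F A i) g = ⊥}

end FreeProductRank

end

/-! Let `G` be a free product of groups `A j`. For a subgroup `H`, the set `G ⧸ H` carries a
bipartite graph, the quotient of a Bass–Serre tree: its vertices are the points `x` and the orbits
("classes") of points under single factors, and the edge `(x, j)` joins `x` to its `A j`-orbit. If
`H` meets all conjugates of the factors trivially, the factors act freely and `H` is the fundamental
group of this graph. A finitely generated nontrivial `H` then has a finite leafless core, whose
negative Euler characteristic is the reduced rank. Only two inequalities are needed:
`card_add_one_le_of_closure_eq` bounds the core by the generators of `H`, and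
`Linked.exists_closure_eq_stabilizer` bounds the generators of a stabilizer by the graph.

The group `H^s ⊓ K` is the stabilizer of a point of `G ⧸ H × G ⧸ K`, and inequivalent `s` give
different orbits. Hence the cores of all nontrivial intersections lie disjointly in the fibre
product of the cores of `H` and `K`, and one estimate of Euler characteristics, `negEuler_le`,
bounds the whole sum. Twice the negative Euler characteristic is the sum of `deg - 2` over all
vertices. At points, `min m n - 2 ≤ (m - 2) * (n - 2)` suffices. Above a pair of classes, with edges
given by finite sets `P`, `Q` in `A j`, degrees are bounded by the representation counts of elements
of `P⁻¹ * Q`; their excess over two is at most `θ * (#P - 2) * (#Q - 2)` by the Kemperman-type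
inequality `le_pollardSum`. This is where finite subgroups of order at least three enter.

The free factor `F` is absorbed by embedding `F * A` into a free product of the `A i` and infinite
cyclic groups, each free generator becoming a product of two cyclic generators. Then every subgroup
in `freeFamily F A` meets the conjugates of all new factors trivially. -/

namespace FreeProductRank

open scoped Pointwise
open Finset

/-! ### Product sets in groups, with products counted at most twice. -/

section Kemperman

variable {Γ : Type*} [Group Γ] [DecidableEq Γ]

/-- The number of representations of `c` as a product of an element of `A` and one of `B`. -/
def repCount (A B : Finset Γ) (c : Γ) : ℕ := #{a ∈ A | a⁻¹ * c ∈ B}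

/-- The number of products of `A` and `B`, where a product is counted at most twice. -/
def pollardSum (A B : Finset Γ) : ℕ := ∑ c ∈ A * B, min 2 (repCount A B c)

lemma repCount_eq_zero {A B : Finset Γ} {c : Γ} (h : c ∉ A * B) : repCount A B c = 0 := by
  rw [repCount, card_eq_zero, filter_eq_empty_iff]
  intro a ha hb
  exact h (by simpa using mul_mem_mul ha hb)

lemma pollardSum_eq {A B C : Finset Γ} (h : A * B ⊆ C) :
    pollardSum A B = ∑ c ∈ C, min 2 (repCount A B c) := by
  apply sum_subset h
  intro c _ hc
  simp [repCount_eq_zero hc]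

lemma repCount_inter_add_union (A A' B : Finset Γ) (c : Γ) :
    repCount (A ∩ A') B c + repCount (A ∪ A') B c = repCount A B c + repCount A' B c := by
  unfold repCount
  rw [filter_union, filter_inter_distrib, add_comm, card_union_add_card_inter]

lemma repCount_mono {A A' B B' : Finset Γ} (h : A ⊆ A') (h' : B ⊆ B') (c : Γ) :
    repCount A B c ≤ repCount A' B' c := by
  apply card_le_card
  intro a ha
  simp only [mem_filter] at ha ⊢
  exact ⟨h ha.1, h' ha.2⟩

lemma pollardSum_mono {A A' B B' : Finset Γ} (h : A ⊆ A') (h' : B ⊆ B') :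
    pollardSum A B ≤ pollardSum A' B' := by
  rw [pollardSum_eq (mul_subset_mul h h')]
  exact sum_le_sum fun c _ => min_le_min le_rfl (repCount_mono h h' c)

/-- Submodularity: for each `c` the two sides have the same total of representation counts, those on
the left are more spread out, and `min 2` is concave. -/
lemma pollardSum_inter_add_union (A A' B : Finset Γ) :
    pollardSum (A ∩ A') B + pollardSum (A ∪ A') B ≤ pollardSum A B + pollardSum A' B := by
  have h1 : A ∩ A' ⊆ A ∪ A' := inter_subset_left.trans subset_union_left
  rw [pollardSum_eq (mul_subset_mul_right (t := B) h1),
    pollardSum_eq (mul_subset_mul_right (t := B) (subset_union_left (s₁ := A) (s₂ := A'))),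
    pollardSum_eq (mul_subset_mul_right (t := B) (subset_union_right (s₁ := A) (s₂ := A'))),
    pollardSum_eq (subset_refl ((A ∪ A') * B)), ← sum_add_distrib, ← sum_add_distrib]
  apply sum_le_sum
  intro c _
  have := repCount_inter_add_union A A' B c
  have := repCount_mono (subset_union_left (s₁ := A) (s₂ := A')) (subset_refl B) c
  have := repCount_mono (subset_union_right (s₁ := A) (s₂ := A')) (subset_refl B) c
  omega

lemma repCount_smul (g : Γ) (A B : Finset Γ) (c : Γ) :
    repCount (g • A) B (g * c) = repCount A B c := by
  unfold repCount
  symm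
  apply card_bij (fun a _ => g * a)
  · intro a ha
    simp only [mem_filter] at ha ⊢
    exact ⟨smul_mem_smul_finset ha.1, by simpa [mul_assoc] using ha.2⟩
  · intro a _ b _ h
    exact mul_left_cancel h
  · intro b hb
    simp only [mem_filter] at hb
    obtain ⟨a, ha, rfl⟩ := mem_smul_finset.1 hb.1
    refine ⟨a, ?_, rfl⟩
    simp only [mem_filter]
    exact ⟨ha, by simpa [mul_assoc] using hb.2⟩

lemma pollardSum_smul (g : Γ) (A B : Finset Γ) : pollardSum (g • A) B = pollardSum A B := by
  unfold pollardSum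
  symm
  apply sum_bij (fun c _ => g * c)
  · intro c hc
    rw [smul_mul_assoc]
    exact smul_mem_smul_finset hc
  · intro a _ b _ h
    exact mul_left_cancel h
  · intro b hb
    rw [smul_mul_assoc] at hb
    obtain ⟨a, ha, rfl⟩ := mem_smul_finset.1 hb
    exact ⟨a, ha, rfl⟩
  · intro c _
    rw [repCount_smul]

lemma repCount_inv (A B : Finset Γ) (c : Γ) : repCount B⁻¹ A⁻¹ c⁻¹ = repCount A B c := by
  unfold repCount
  symm
  apply card_bij (fun a _ => c⁻¹ * a)
  · intro a ha
    simp only [mem_filter, mem_inv'] at ha ⊢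
    simpa [mul_assoc] using ha.symm
  · intro a _ b _ h
    exact mul_left_cancel h
  · intro b hb
    simp only [mem_filter, mem_inv'] at hb
    refine ⟨c * b, ?_, by simp⟩
    simp only [mem_filter]
    simpa [mul_assoc] using hb.symm

lemma pollardSum_inv (A B : Finset Γ) : pollardSum B⁻¹ A⁻¹ = pollardSum A B := by
  unfold pollardSum
  rw [← mul_inv_rev]
  symm
  apply sum_bij (fun c _ => c⁻¹)
  · intro c hc
    rw [mem_inv', inv_inv]
    exact hc
  · intro a _ b _ h
    exact inv_injective h
  · intro b hb
    exact ⟨b⁻¹, mem_inv'.1 hb, by simp⟩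
  · intro c _
    rw [repCount_inv]

lemma sum_repCount (A B : Finset Γ) : ∑ c ∈ A * B, repCount A B c = #A * #B := by
  rw [← card_product, card_eq_sum_card_fiberwise (f := fun q : Γ × Γ => q.1 * q.2) (t := A * B)]
  · apply sum_congr rfl
    intro c _
    unfold repCount
    apply card_bij (fun a _ => (a, a⁻¹ * c))
    · intro a ha
      simp only [mem_filter, mem_product] at ha ⊢
      simpa using ha
    · intro a _ b _ h
      exact (Prod.ext_iff.1 h).1
    · rintro ⟨a, b⟩ h
      simp only [mem_filter, mem_product] at h
      refine ⟨a, ?_, ?_⟩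
      · simp [← h.2, h.1.1, h.1.2]
      · simp [← h.2]
  · rintro ⟨a, b⟩ h
    simp only [coe_product, Set.mem_prod, mem_coe] at h
    exact mul_mem_mul h.1 h.2

lemma sum_repCount_sub_two (A B : Finset Γ) :
    ∑ c ∈ A * B, (repCount A B c - 2) + pollardSum A B = #A * #B := by
  rw [← sum_repCount, pollardSum, ← sum_add_distrib]
  apply sum_congr rfl
  intro c _
  omega

lemma repCount_le_right (A B : Finset Γ) (c : Γ) : repCount A B c ≤ #B := by
  apply card_le_card_of_injOn (fun a => a⁻¹ * c)
  · intro a ha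
    simp only [coe_filter, Set.mem_ofPred_eq] at ha
    exact ha.2
  · intro a _ b _ h
    simpa using h

lemma pollardSum_of_card_le_two {A B : Finset Γ} (h : #B ≤ 2) : pollardSum A B = #A * #B := by
  rw [← sum_repCount, pollardSum]
  apply sum_congr rfl
  intro c _
  have := repCount_le_right A B c
  omega

lemma two_mul_card_le_pollardSum {A B : Finset Γ} (h : 2 ≤ #B) : 2 * #A ≤ pollardSum A B := by
  obtain ⟨B', hB', hc⟩ := exists_subset_card_eq h
  have := pollardSum_mono (subset_refl A) hB'
  rw [pollardSum_of_card_le_two hc.le, hc] at this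
  omega

lemma two_mul_card_le_pollardSum' {A B : Finset Γ} (h : 2 ≤ #A) : 2 * #B ≤ pollardSum A B := by
  rw [← pollardSum_inv]
  simpa using two_mul_card_le_pollardSum (A := B⁻¹) (B := A⁻¹) (by simpa using h)

lemma repCount_insert {A B : Finset Γ} {b : Γ} (hb : b ∉ B) (c : Γ) :
    repCount A (insert b B) c = repCount A B c + if c * b⁻¹ ∈ A then 1 else 0 := by
  have : ({a ∈ A | a⁻¹ * c ∈ insert b B} : Finset Γ) =
      {a ∈ A | a⁻¹ * c ∈ B} ∪ {a ∈ A | a⁻¹ * c = b} := by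
    ext a; simp only [mem_filter, mem_insert, mem_union]; tauto
  unfold repCount
  rw [this, card_union_of_disjoint]
  · congr 1
    split_ifs with h
    · rw [card_eq_one]
      refine ⟨c * b⁻¹, ?_⟩
      ext a
      simp only [mem_filter, mem_singleton]
      constructor
      · rintro ⟨_, rfl⟩; simp
      · rintro rfl; exact ⟨h, by simp⟩
    · rw [card_eq_zero, filter_eq_empty_iff]
      rintro a ha rfl
      exact h (by simpa using ha)
  · rw [disjoint_filter]
    rintro a _ h1 rfl
    exact hb h1

lemma pollardSum_insert {A B : Finset Γ} {b : Γ} (hb : b ∉ B) :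
    pollardSum A (insert b B) = pollardSum A B + #{a ∈ A | repCount A B (a * b) ≤ 1} := by
  have h : A * B ⊆ A * insert b B := mul_subset_mul_left (subset_insert _ _)
  rw [pollardSum_eq h, pollardSum]
  have : #{a ∈ A | repCount A B (a * b) ≤ 1} =
      ∑ c ∈ A * insert b B, if c * b⁻¹ ∈ A ∧ repCount A B c ≤ 1 then 1 else 0 := by
    rw [← card_filter]
    apply card_bij (fun a _ => a * b)
    · intro a ha
      simp only [mem_filter] at ha ⊢
      exact ⟨mul_mem_mul ha.1 (mem_insert_self _ _), by simpa using ha.1, ha.2⟩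
    · intro a _ a' _ h
      exact mul_right_cancel h
    · intro c hc
      simp only [mem_filter] at hc
      exact ⟨c * b⁻¹, by simpa using hc.2, by simp⟩
  rw [this, ← sum_add_distrib]
  apply sum_congr rfl
  intro c _
  rw [repCount_insert hb]
  by_cases h1 : c * b⁻¹ ∈ A <;> by_cases h2 : repCount A B c ≤ 1 <;> simp only [h1, h2] <;> simp <;> omega

/-- Distinct left translates of `A` meet in at most one element. -/
def TranslatesMeetInOne (A : Finset Γ) : Prop := ∀ g : Γ, 2 ≤ #(A ∩ g • A) → g • A = A

lemma card_stabilizer_le {A : Finset Γ} (hA : A.Nonempty) :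
    Finite (MulAction.stabilizer Γ A) ∧ Nat.card (MulAction.stabilizer Γ A) ≤ #A := by
  obtain ⟨a, ha⟩ := hA
  have hf : Function.Injective (fun g : MulAction.stabilizer Γ A =>
      (⟨(g : Γ) * a, by
        have h := g.2
        rw [MulAction.mem_stabilizer_iff] at h
        have h2 := smul_mem_smul_finset (a := (g : Γ)) ha
        rw [h] at h2
        exact h2⟩ : A)) := by
    intro g h hgh
    simpa using hgh
  refine ⟨Finite.of_injective _ hf, ?_⟩
  simpa using Nat.card_le_card_of_injective _ hf

/-- If `a` and `a₀` both lie in the set, then `A` and its translate by `a * a₀⁻¹` share the two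
elements `a` and `a * x`, so this translation stabilizes `A`. -/
lemma card_inter_mul_right_le {A : Finset Γ} (hA : A.Nonempty) (hT : TranslatesMeetInOne A) {x : Γ}
    (hx : x ≠ 1) : #{a ∈ A | a * x ∈ A} ≤ Nat.card (MulAction.stabilizer Γ A) := by
  have := (card_stabilizer_le hA).1
  rcases ({a ∈ A | a * x ∈ A} : Finset Γ).eq_empty_or_nonempty with h0 | ⟨a₀, h₀⟩
  · simp [h0]
  simp only [mem_filter] at h₀
  have key : ∀ a : ({a ∈ A | a * x ∈ A} : Finset Γ),
      (a : Γ) * a₀⁻¹ ∈ MulAction.stabilizer Γ A := by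
    rintro ⟨a, ha⟩
    simp only [mem_filter] at ha
    rw [MulAction.mem_stabilizer_iff]
    apply hT
    have hsub : ({a, a * x} : Finset Γ) ⊆ A ∩ (a * a₀⁻¹) • A := by
      intro y hy
      simp only [mem_insert, mem_singleton] at hy
      rw [mem_inter, mem_smul_finset]
      rcases hy with rfl | rfl
      · exact ⟨ha.1, a₀, h₀.1, by simp⟩
      · exact ⟨ha.2, a₀ * x, h₀.2, by simp [mul_assoc]⟩
    have := card_le_card hsub
    rwa [card_pair] at this
    simpa using hx
  have hf : Function.Injective (fun a : ({a ∈ A | a * x ∈ A} : Finset Γ) =>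
      (⟨(a : Γ) * a₀⁻¹, key a⟩ : MulAction.stabilizer Γ A)) := by
    intro a b h
    ext
    simpa using h
  have h3 := Nat.card_le_card_of_injective _ hf
  rw [Nat.card_eq_fintype_card, Fintype.card_coe] at h3
  exact h3

omit [DecidableEq Γ] in
lemma even_card_of_involution {A : Finset Γ} {g : Γ} (hg : g ≠ 1) (hgg : g * g = 1)
    (h : ∀ a ∈ A, g * a ∈ A) : Even #A := by
  have := Finset.sum_involution (s := A) (f := fun _ => (1 : ZMod 2)) (fun a _ => g * a)
    (fun _ _ => by decide) (fun a _ _ => by simpa using hg) h (fun a _ => by simp [← mul_assoc, hgg])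
  rw [sum_const, nsmul_eq_mul, mul_one, ZMod.natCast_eq_zero_iff] at this
  exact even_iff_two_dvd.2 this

/-- If the translates of `A` meet in at most one element then adding one more element `b` to a
set `B` of less than `#A` elements gives at least two new products. -/
lemma two_le_card_new {A B : Finset Γ} {b : Γ} (hA : 3 ≤ #A) (hT : TranslatesMeetInOne A)
    (hL : Nat.card (MulAction.stabilizer Γ A) ≤ 2) (hb : b ∉ B) (hBA : #B < #A) :
    2 ≤ #{a ∈ A | repCount A B (a * b) ≤ 1} := by
  have hne : A.Nonempty := card_pos.1 (by omega)
  set L := MulAction.stabilizer Γ A with hLdef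
  have := (card_stabilizer_le hne).1
  -- Double counting of pairs `(a, b')` with `a * b * b'⁻¹ ∈ A`: each bad `a` occurs at least twice,
  -- and each `b'` at most `Nat.card L` times.
  have h1 : 2 * #{a ∈ A | ¬ repCount A B (a * b) ≤ 1} ≤ #B * Nat.card L := by
    calc 2 * #{a ∈ A | ¬ repCount A B (a * b) ≤ 1}
        ≤ ∑ a ∈ A with ¬ repCount A B (a * b) ≤ 1, #{b' ∈ B | a * b * b'⁻¹ ∈ A} := by
          rw [mul_comm, ← smul_eq_mul]
          apply card_nsmul_le_sum
          intro a ha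
          simp only [mem_filter, not_le] at ha
          refine le_trans ha.2 ?_
          apply card_le_card_of_injOn (fun x => x⁻¹ * (a * b))
          · intro x hx
            simp only [coe_filter, Set.mem_ofPred_eq] at hx ⊢
            exact ⟨hx.2, by simpa [mul_assoc] using hx.1⟩
          · intro x _ y _ h
            simpa using h
      _ ≤ ∑ a ∈ A, #{b' ∈ B | a * b * b'⁻¹ ∈ A} :=
          sum_le_sum_of_subset (filter_subset _ _)
      _ = ∑ b' ∈ B, #{a ∈ A | a * (b * b'⁻¹) ∈ A} := by
          simp only [card_filter, mul_assoc]
          rw [sum_comm]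
      _ ≤ #B * Nat.card L := by
          rw [← smul_eq_mul]
          apply sum_le_card_nsmul
          intro b' hb'
          apply card_inter_mul_right_le hne hT
          intro h
          rw [mul_inv_eq_one] at h
          exact hb (h ▸ hb')
  have h2 : #{a ∈ A | repCount A B (a * b) ≤ 1} + #{a ∈ A | ¬ repCount A B (a * b) ≤ 1} = #A :=
    card_filter_add_card_filter_not _
  have hpos : 0 < Nat.card L := Nat.card_pos
  -- For a trivial stabilizer at most half of `#B` elements are bad, which is enough as `3 ≤ #A`.
  -- For order two the count leaves only one good element, and parity supplies the second: the
  -- involution acts freely on the good ones.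
  rcases (by omega : Nat.card L = 1 ∨ Nat.card L = 2) with h | h
  · rw [h] at h1; omega
  · rw [h] at h1
    have hnt : Nontrivial L := by
      rw [← Finite.one_lt_card_iff_nontrivial]; omega
    obtain ⟨⟨g, hgL⟩, hg⟩ := exists_ne (1 : L)
    have hg1 : g ≠ 1 := fun h' => hg (Subtype.ext h')
    have hgg : g * g = 1 := by
      have := pow_card_eq_one' (x := (⟨g, hgL⟩ : L))
      rw [h, pow_two] at this
      exact congrArg Subtype.val this
    have hgA : g • A = A := hgL
    have : Even #{a ∈ A | repCount A B (a * b) ≤ 1} := by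
      apply even_card_of_involution hg1 hgg
      intro a ha
      simp only [mem_filter] at ha ⊢
      constructor
      · have := smul_mem_smul_finset (a := g) ha.1
        rwa [hgA] at this
      · have := repCount_smul g A B (a * b)
        rw [hgA] at this
        rw [mul_assoc, this]
        exact ha.2
    obtain ⟨k, hk⟩ := this
    omega

lemma pollardSum_lower_bound {A B : Finset Γ} (hA : 3 ≤ #A) (hT : TranslatesMeetInOne A)
    (hL : Nat.card (MulAction.stabilizer Γ A) ≤ 2) (hB : 2 ≤ #B) (hBA : #B ≤ #A) :
    2 * #A + 2 * (#B - 2) ≤ pollardSum A B := by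
  obtain ⟨n, hn⟩ := Nat.exists_eq_add_of_le hB
  induction n generalizing B with
  | zero => have := two_mul_card_le_pollardSum (A := A) hB; omega
  | succ n ih =>
    obtain ⟨b, B', hb, rfl, hc⟩ := card_eq_succ.1 (show #B = (2 + n) + 1 by omega)
    have := ih (B := B') (by omega) (by omega) (by omega)
    rw [pollardSum_insert hb]
    have := two_le_card_new hA hT hL hb (by omega)
    omega

/-- The sets that violate the Kemperman-type inequality. -/
def Violates (u v : ℤ) (A B : Finset Γ) : Prop :=
  v * pollardSum A B < v * (#A * #B) - u * ((#A - 2) * (#B - 2))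

lemma Violates.inv {u v : ℤ} {A B : Finset Γ} (h : Violates u v A B) : Violates u v B⁻¹ A⁻¹ := by
  unfold Violates at *
  rw [pollardSum_inv, card_inv, card_inv]
  linarith

/-- An uncrossing argument. For a minimal violator `A₁`, if `A₁ ∩ g • A₁` has at least two elements,
submodularity makes it minimal too, so by minimal cardinality it is all of `A₁`. -/
lemma Violates.exists_translatesMeetInOne {u v : ℤ} (hv : 0 < v) (huv : v ≤ u) {A B : Finset Γ}
    (hA : 2 ≤ #A) (hB : 2 ≤ #B) (h : Violates u v A B) :
    ∃ A' : Finset Γ, 2 ≤ #A' ∧ Violates u v A' B ∧ TranslatesMeetInOne A' := by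
  classical
  -- For fixed `B`, `Φ` is `v * pollardSum` minus a multiple of the cardinality, so it stays
  -- submodular, and violation means that it lies below a constant. The hypothesis `v ≤ u` gives `0
  -- ≤ Φ`, so `toNat` below loses nothing.
  let Φ : Finset Γ → ℤ := fun A => v * pollardSum A B - (v * #B - u * (#B - 2)) * #A
  have hΦ : ∀ A, Violates u v A B ↔ Φ A < 2 * u * (#B - 2) := by
    intro A
    simp only [Φ, Violates]
    constructor <;> intro h <;> linarith
  have hnn : ∀ A, 2 ≤ #A → 0 ≤ Φ A := by
    intro A _
    have h1 : (2 * #A : ℤ) ≤ pollardSum A B := by exact_mod_cast two_mul_card_le_pollardSum hB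
    have h2 : (2 : ℤ) ≤ #B := by exact_mod_cast hB
    simp only [Φ]
    have h3 : (v * #B - u * (#B - 2)) ≤ 2 * v := by nlinarith
    have h4 := mul_le_mul_of_nonneg_right h3 (Nat.cast_nonneg (α := ℤ) #A)
    nlinarith
  let P : ℕ ×ₗ ℕ → Prop := fun q => ∃ A : Finset Γ, 2 ≤ #A ∧ q = toLex ((Φ A).toNat, #A)
  obtain ⟨q, ⟨A₁, hA₁, rfl⟩, hmin⟩ := WellFounded.has_min (wellFounded_lt (α := ℕ ×ₗ ℕ)) {q | P q}
    ⟨_, A, hA, rfl⟩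
  have hmin' : ∀ A₂ : Finset Γ, 2 ≤ #A₂ → Φ A₁ ≤ Φ A₂ ∧ (Φ A₂ = Φ A₁ → #A₁ ≤ #A₂) := by
    intro A₂ hA₂
    have := hmin (toLex ((Φ A₂).toNat, #A₂)) ⟨A₂, hA₂, rfl⟩
    rw [Prod.Lex.toLex_lt_toLex] at this
    push Not at this
    have h1 := hnn A₁ hA₁
    have h2 := hnn A₂ hA₂
    simp only at this
    refine ⟨by omega, fun h => this.2 (by rw [h])⟩
  refine ⟨A₁, hA₁, ?_, ?_⟩
  · rw [hΦ] at h ⊢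
    exact (hmin' A hA).1.trans_lt h
  · intro g hg
    have hsub := pollardSum_inter_add_union A₁ (g • A₁) B
    rw [pollardSum_smul] at hsub
    have hcard := card_union_add_card_inter A₁ (g • A₁)
    rw [card_smul_finset] at hcard
    have hsum : Φ (A₁ ∩ g • A₁) + Φ (A₁ ∪ g • A₁) ≤ 2 * Φ A₁ := by
      simp only [Φ]
      have e1 : ((#(A₁ ∪ g • A₁) : ℤ) + #(A₁ ∩ g • A₁)) = #A₁ + #A₁ := by exact_mod_cast hcard
      have e2 : (pollardSum (A₁ ∩ g • A₁) B : ℤ) + pollardSum (A₁ ∪ g • A₁) B ≤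
        pollardSum A₁ B + pollardSum A₁ B := by exact_mod_cast hsub
      have e3 := mul_le_mul_of_nonneg_left e2 hv.le
      have e4 : (v * #B - u * (#B - 2)) * ((#(A₁ ∪ g • A₁) : ℤ) + #(A₁ ∩ g • A₁)) =
        (v * #B - u * (#B - 2)) * (#A₁ + #A₁) := by rw [e1]
      linarith
    have i1 := hmin' _ hg
    have i2 := hmin' (A₁ ∪ g • A₁) (hA₁.trans (card_le_card subset_union_left))
    have i3 := i1.2 (by linarith [i1.1, i2.1])
    have i4 := eq_of_subset_of_card_le inter_subset_left i3
    have i5 : A₁ ⊆ g • A₁ := i4.symm.subset.trans inter_subset_right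
    exact (eq_of_subset_of_card_le i5 (by rw [card_smul_finset])).symm

/-- A Kemperman-type inequality. -/
theorem le_pollardSum {u v : ℤ} (hv : 0 < v) (huv : v ≤ u)
    (hL : ∀ L : Subgroup Γ, Finite L → 3 ≤ Nat.card L → v * Nat.card L ≤ u * (Nat.card L - 2))
    {A B : Finset Γ} (hA : 2 ≤ #A) (hB : 2 ≤ #B) :
    v * (#A * #B) - u * ((#A - 2) * (#B - 2)) ≤ v * pollardSum A B := by
  by_contra! hlt
  have hstab : ∀ {A B : Finset Γ}, 2 ≤ #A → 2 ≤ #B → Violates u v A B →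
      3 ≤ #A ∧ Nat.card (MulAction.stabilizer Γ A) ≤ 2 := by
    intro A B hA hB h
    unfold Violates at h
    have hA3 : 3 ≤ #A := by
      by_contra hA3
      have e : #A = 2 := by omega
      have := two_mul_card_le_pollardSum' (B := B) hA
      have : (2 * #B : ℤ) ≤ pollardSum A B := by exact_mod_cast this
      rw [e] at h
      push_cast at h
      nlinarith
    refine ⟨hA3, ?_⟩
    by_contra! h3
    have hne : A.Nonempty := card_pos.1 (by omega)
    obtain ⟨hfin, hle⟩ := card_stabilizer_le hne
    have h4 := hL _ hfin h3
    have h5 : (2 * #A : ℤ) ≤ pollardSum A B := by exact_mod_cast two_mul_card_le_pollardSum hB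
    set l : ℤ := (Nat.card (MulAction.stabilizer Γ A) : ℤ)
    have h6 : l ≤ #A := by simpa [l] using hle
    -- The bound `hL` for the stabilizer passes to the larger number `#A` because `v ≤ u`. It makes
    -- the trivial estimate `2 * #A ≤ pollardSum A B` sufficient.
    have h7 : v * #A ≤ u * (#A - 2) := by nlinarith
    have h8 : (0 : ℤ) ≤ #B - 2 := by have : (2 : ℤ) ≤ #B := by exact_mod_cast hB
                                     linarith
    have h9 := mul_le_mul_of_nonneg_right h7 h8
    have h10 := mul_le_mul_of_nonneg_left h5 hv.le
    linarith
  have hfinal : ∀ {A B : Finset Γ}, 2 ≤ #A → 2 ≤ #B → Violates u v A B → TranslatesMeetInOne A →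
      #B ≤ #A → False := by
    intro A B hA hB h hT hBA
    obtain ⟨h3, h4⟩ := hstab hA hB h
    have h5 := pollardSum_lower_bound h3 hT h4 hB hBA
    have h6 : (2 : ℤ) * #A + 2 * (#B - 2) ≤ pollardSum A B := by
      have : ((2 * #A + 2 * (#B - 2) : ℕ) : ℤ) ≤ pollardSum A B := by exact_mod_cast h5
      rw [← Nat.cast_two, ← Nat.cast_sub hB]
      exact_mod_cast this
    unfold Violates at h
    have h7 := mul_le_mul_of_nonneg_left h6 hv.le
    have hA' : (0 : ℤ) ≤ #A - 2 := by have : (2 : ℤ) ≤ #A := by exact_mod_cast hA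
                                      linarith
    have hB' : (0 : ℤ) ≤ #B - 2 := by have : (2 : ℤ) ≤ #B := by exact_mod_cast hB
                                      linarith
    -- The lower bound `2 * #A + 2 * (#B - 2)` equals `#A * #B - (#A - 2) * (#B - 2)`, the case `u =
    -- v` of the claim.
    have h8 := mul_le_mul_of_nonneg_right huv (mul_nonneg hA' hB')
    linarith
  obtain ⟨A₁, hA₁, hv₁, hT₁⟩ := Violates.exists_translatesMeetInOne hv huv hA hB hlt
  obtain ⟨B₁, hB₁, hv₂, hT₂⟩ := Violates.exists_translatesMeetInOne hv huv
    (A := B⁻¹) (B := A₁⁻¹) (by rwa [card_inv]) (by rwa [card_inv]) hv₁.inv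
  -- Both sets now have the translate property, so the larger one can take the role of `A`, after an
  -- inversion if necessary.
  rcases le_total #A₁ #B₁ with h | h
  · exact hfinal hB₁ (by rwa [card_inv]) hv₂ hT₂ (by rwa [card_inv])
  · have := hv₂.inv
    rw [inv_inv] at this
    exact hfinal hA₁ (by rwa [card_inv]) this hT₁ (by rwa [card_inv])

end Kemperman
end FreeProductRank

namespace FreeProductRank

open Monoid Monoid.CoprodI

/-! ### Paths in graphs of orbits, and normal forms. -/

section Reach

variable {J : Type*} {A : J → Type*} [∀ j, Group (A j)]
variable {X Y : Type*} [MulAction (CoprodI A) X] [MulAction (CoprodI A) Y]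

/-- `Reach D x g` says that `g` is a product of elements of the factors that moves `x` along
edges of `D`: an edge `(y, j)` joins the point `y` to its orbit under the factor `A j`. -/
inductive Reach (D : Set (X × J)) (x : X) : CoprodI A → Prop
  | one : Reach D x 1
  | step {g : CoprodI A} {j : J} (a : A j) : Reach D x g → (g • x, j) ∈ D →
      ((of a * g) • x, j) ∈ D → Reach D x (of a * g)

lemma Reach.mono {D E : Set (X × J)} (h : D ⊆ E) {x : X} {g : CoprodI A} (hg : Reach D x g) :
    Reach E x g := by
  induction hg with
  | one => exact .one
  | step a _ h1 h2 ih => exact .step a ih (h h1) (h h2)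

lemma Reach.trans {D : Set (X × J)} {x : X} {g k : CoprodI A} (hg : Reach D x g)
    (hk : Reach D (g • x) k) : Reach D x (k * g) := by
  induction hk with
  | one => simpa using hg
  | step a _ h1 h2 ih =>
    rw [mul_assoc]
    refine .step a ih ?_ ?_
    · simpa [mul_smul] using h1
    · simpa [mul_smul] using h2

lemma Reach.single {D : Set (X × J)} {x : X} {j : J} (a : A j) (h1 : (x, j) ∈ D)
    (h2 : (of a • x, j) ∈ D) : Reach D x (of a) := by
  simpa using Reach.step a (.one : Reach D x 1) (by simpa using h1) (by simpa using h2)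

lemma Reach.symm {D : Set (X × J)} {x : X} {g : CoprodI A} (hg : Reach D x g) :
    Reach D (g • x) g⁻¹ := by
  induction hg with
  | one => simpa using .one
  | @step g j a _ h1 h2 ih =>
    rw [mul_inv_rev]
    have h3 : Reach D ((of a * g) • x) (of a)⁻¹ := by
      rw [← map_inv]
      refine Reach.single _ h2 ?_
      simpa [mul_smul] using h1
    refine h3.trans ?_
    simpa [mul_smul] using ih

/-- The element of the free product that is represented by a list of letters. -/
def listProd (l : List (Σ j, A j)) : CoprodI A := (l.map fun s => of s.2).prod

/-- The word `l`, read from right to left, moves `x` along edges of `D`. -/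
def PathIn (D : Set (X × J)) (x : X) : List (Σ j, A j) → Prop
  | [] => True
  | s :: l => PathIn D x l ∧ (listProd l • x, s.1) ∈ D ∧ ((of s.2 * listProd l) • x, s.1) ∈ D

lemma listProd_cons (s : Σ j, A j) (l : List (Σ j, A j)) :
    listProd (s :: l) = of s.2 * listProd l := by
  simp [listProd]

/-- Reducing a path to normal form does not leave `D`: consecutive letters from one factor pass
through the same class, so merging or cancelling them only drops edges. -/
lemma Reach.exists_word {D : Set (X × J)} {x : X} {g : CoprodI A} (hg : Reach D x g) :
    ∃ w : Word A, w.prod = g ∧ PathIn D x w.toList := by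
  classical
  induction hg with
  | one => exact ⟨.empty, rfl, trivial⟩
  | @step g j a _ h1 h2 ih =>
    obtain ⟨w, rfl, hw⟩ := ih
    have key : PathIn D x (Word.equivPair j w).tail.toList ∧
        ((Word.equivPair j w).tail.prod • x, j) ∈ D := by
      have hr : Word.rcons (Word.equivPair j w) = w := (Word.equivPair j).symm_apply_apply w
      by_cases h : (Word.equivPair j w).head = 1
      · have hr' : (Word.equivPair j w).tail = w := by
          rw [Word.rcons, dif_pos h] at hr
          exact hr
        rw [hr']
        exact ⟨hw, h1⟩
      · rw [Word.rcons, dif_neg h] at hr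
        rw [← hr, Word.cons_toList] at hw
        exact ⟨hw.1, hw.2.1⟩
    refine ⟨of a • w, by rw [Word.prod_smul], ?_⟩
    have hp := Word.prod_smul (of a) w
    rw [Word.of_smul_def] at hp ⊢
    rw [← hp] at h2
    by_cases h : a * (Word.equivPair j w).head = 1
    · rw [Word.rcons, dif_pos h]
      exact key.1
    · rw [Word.prod_rcons] at h2
      rw [Word.rcons, dif_neg h]
      exact ⟨key.1, key.2, h2⟩

lemma PathIn.reach {D : Set (X × J)} {x : X} {l : List (Σ j, A j)} (h : PathIn D x l) :
    Reach D x (listProd l) := by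
  induction l with
  | nil => exact .one
  | cons s l ih =>
    rw [listProd_cons]
    exact .step _ (ih h.1) h.2.1 h.2.2

/-- The fibre product of `D` and `E`. -/
def fiberProd (D : Set (X × J)) (E : Set (Y × J)) : Set ((X × Y) × J) :=
  {e | (e.1.1, e.2) ∈ D ∧ (e.1.2, e.2) ∈ E}

/-- By uniqueness of normal forms, the reduced paths in `D` and in `E` spell the same word and can
be followed simultaneously. -/
lemma Reach.prod {D : Set (X × J)} {E : Set (Y × J)} {x : X} {y : Y} {g : CoprodI A}
    (h1 : Reach D x g) (h2 : Reach E y g) : Reach (fiberProd D E) (x, y) g := by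
  classical
  obtain ⟨w, hw, hD⟩ := h1.exists_word
  obtain ⟨w', hw', hE⟩ := h2.exists_word
  obtain rfl : w = w' := Word.equiv.symm.injective (hw.trans hw'.symm)
  have key : ∀ l : List (Σ j, A j), PathIn D x l → PathIn E y l →
      PathIn (fiberProd D E) (x, y) l := by
    intro l
    induction l with
    | nil => exact fun _ _ => trivial
    | cons s l ih => exact fun h h' => ⟨ih h.1 h'.1, ⟨h.2.1, h'.2.1⟩, ⟨h.2.2, h'.2.2⟩⟩
  rw [← hw]
  exact (key _ hD hE).reach

end Reach

/-! ### Integration of edge functions over the free product. -/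

section Potential

variable {J : Type*} {A : J → Type*} [∀ j, Group (A j)] {M : Type*} [AddCommGroup M]

/-- The action of a factor on pairs, that records the changes of `f`. -/
def potentialAux (f : CoprodI A → J → M) (j : J) : A j →* Equiv.Perm (CoprodI A × M) where
  toFun a :=
    { toFun := fun q => (of a * q.1, q.2 + (f (of a * q.1) j - f q.1 j))
      invFun := fun q => ((of a)⁻¹ * q.1, q.2 - (f q.1 j - f ((of a)⁻¹ * q.1) j))
      left_inv := fun q => by simp
      right_inv := fun q => by simp }
  map_one' := by
    ext q <;> simp
  map_mul' a b := by
    ext q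
    · simp [mul_assoc]
    · simp only [map_mul, Equiv.coe_fn_mk, Equiv.Perm.mul_apply, mul_assoc]
      abel

/-- The function on the free product with `potential f 1 = 0` whose increments along left
multiplication by elements of the factor `A j` are those of `f · j`. -/
def potential (f : CoprodI A → J → M) (g : CoprodI A) : M :=
  (CoprodI.lift (potentialAux f) g (1, 0)).2

@[simp] lemma potential_one (f : CoprodI A → J → M) : potential f 1 = 0 := by
  simp [potential]

lemma potential_of_mul (f : CoprodI A → J → M) {j : J} (a : A j) (g : CoprodI A) :
    potential f (of a * g) = potential f g + (f (of a * g) j - f g j) := by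
  have h : ∀ (g : CoprodI A) (q : CoprodI A × M),
      (CoprodI.lift (potentialAux f) g q).1 = g * q.1 := by
    intro g
    induction g using CoprodI.induction_on with
    | one => intro q; simp
    | of j a => intro q; simp [potentialAux]
    | mul g k hg hk => intro q; rw [map_mul, Equiv.Perm.mul_apply, hg, hk, mul_assoc]
  have h1 := h g (1, 0)
  unfold potential
  rw [map_mul, Equiv.Perm.mul_apply, lift_of]
  simp only [potentialAux, MonoidHom.coe_mk, OneHom.coe_mk, Equiv.coe_fn_mk, h1, mul_one]

lemma eq_of_forall_of_mul_eq {N : Type*} {q : CoprodI A → N}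
    (h : ∀ (j : J) (a : A j) (g : CoprodI A), q (of a * g) = q g) (g : CoprodI A) : q g = q 1 := by
  have : ∀ g k : CoprodI A, q (g * k) = q k := by
    intro g
    induction g using CoprodI.induction_on with
    | one => simp
    | of j a => exact h j a
    | mul g g' hg hg' => intro k; rw [mul_assoc, hg, hg']
  simpa using this g 1

lemma potential_add (f f' : CoprodI A → J → M) (g : CoprodI A) :
    potential (f + f') g = potential f g + potential f' g := by
  have := eq_of_forall_of_mul_eq
    (q := fun g => potential (f + f') g - (potential f g + potential f' g))
    (fun j a g => by simp only [potential_of_mul, Pi.add_apply]; abel) g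
  simpa [sub_eq_zero] using this

lemma potential_smul {R : Type*} [Ring R] [Module R M] (r : R) (f : CoprodI A → J → M)
    (g : CoprodI A) : potential (r • f) g = r • potential f g := by
  have := eq_of_forall_of_mul_eq (q := fun g => potential (r • f) g - r • potential f g)
    (fun j a g => by simp only [potential_of_mul, Pi.smul_apply, smul_add, smul_sub]; abel) g
  simpa [sub_eq_zero] using this

lemma potential_mul_of_invariant {f : CoprodI A → J → M} {k : CoprodI A}
    (hk : ∀ g j, f (g * k) j = f g j) (g : CoprodI A) :
    potential f (g * k) = potential f g + potential f k := by
  have := eq_of_forall_of_mul_eq (q := fun g => potential f (g * k) - potential f g)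
    (fun j a g => by simp only [mul_assoc, potential_of_mul]; simp only [← mul_assoc, hk]; abel) g
  simp only [one_mul, potential_one, sub_zero] at this
  rw [← this]; abel

end Potential

/-! ### Finite graphs of orbits; Betti number against number of generators. -/

section Graph

open Finset

variable {J : Type*} {A : J → Type*} [∀ j, Group (A j)]
variable {X : Type*} [MulAction (CoprodI A) X]

variable (A) in
/-- The orbit of an edge `(x, j)` under the factor `A j`. -/
def edgeClass (e : X × J) : Set X × J := (Set.range fun a : A e.2 => of a • e.1, e.2)

lemma edgeClass_eq_iff {x y : X} {i j : J} :
    edgeClass A (x, i) = edgeClass A (y, j) ↔ i = j ∧ ∃ a : A j, y = of a • x := by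
  constructor
  · intro h
    obtain rfl : i = j := congrArg Prod.snd h
    refine ⟨rfl, ?_⟩
    have h1 : y ∈ (edgeClass A (y, i)).1 := ⟨1, by simp⟩
    rw [← h] at h1
    obtain ⟨a, ha⟩ := h1
    exact ⟨a, ha.symm⟩
  · rintro ⟨rfl, a, rfl⟩
    refine Prod.ext (Set.ext fun z => ?_) rfl
    constructor
    · rintro ⟨b, rfl⟩
      exact ⟨b * a⁻¹, by simp [mul_smul]⟩
    · rintro ⟨b, rfl⟩
      exact ⟨b * a, by simp [mul_smul]⟩

open Classical in
/-- The points that lie on an edge of `D`. -/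
noncomputable def points {X : Type*} (D : Finset (X × J)) : Finset X := D.image Prod.fst

variable (A) in
open Classical in
/-- The orbits of edges of `D` under the factors. -/
noncomputable def classes (D : Finset (X × J)) : Finset (Set X × J) := D.image (edgeClass A)

lemma mem_points {X : Type*} {D : Finset (X × J)} {x : X} : x ∈ points D ↔ ∃ j, (x, j) ∈ D := by
  simp [points]

lemma fst_mem_points {X : Type*} {D : Finset (X × J)} {e : X × J} (he : e ∈ D) :
    e.1 ∈ points D := mem_points.2 ⟨e.2, he⟩

lemma mem_classes {D : Finset (X × J)} {c : Set X × J} :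
    c ∈ classes A D ↔ ∃ e ∈ D, edgeClass A e = c := by
  simp only [classes, mem_image]

lemma edgeClass_mem_classes {D : Finset (X × J)} {e : X × J} (he : e ∈ D) :
    edgeClass A e ∈ classes A D := mem_classes.2 ⟨e, he, rfl⟩

/-- A finite nonempty graph in `G ⧸ H` has first Betti number at most the number of generators
of `H`. -/
lemma card_add_one_le_of_closure_eq {H : Subgroup (CoprodI A)} {T : Finset (CoprodI A)}
    (hT : Subgroup.closure (T : Set (CoprodI A)) = H)
    {D : Finset ((CoprodI A ⧸ H) × J)} (hD : D.Nonempty) :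
    #D + 1 ≤ #(points D) + #(classes A D) + #T := by
  classical
  -- Cohomology with coefficients in a field; the choice of the field is immaterial.
  let 𝔽 := ZMod 2
  have : Fact (Nat.Prime 2) := ⟨Nat.prime_two⟩
  let ext : (D → 𝔽) → CoprodI A → J → 𝔽 := fun f g j =>
    if h : ((g : CoprodI A ⧸ H), j) ∈ D then f ⟨_, h⟩ else 0
  have ext_add : ∀ f f', ext (f + f') = ext f + ext f' := by
    intro f f'; funext g j; simp only [ext, Pi.add_apply]; split_ifs <;> simp
  have ext_smul : ∀ (r : 𝔽) f, ext (r • f) = r • ext f := by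
    intro r f; funext g j; simp only [ext, Pi.smul_apply]; split_ifs <;> simp
  let Φ : (D → 𝔽) →ₗ[𝔽] (T → 𝔽) :=
    { toFun := fun f t => potential (ext f) t
      map_add' := fun f f' => by funext t; simp [ext_add, potential_add]
      map_smul' := fun r f => by
        funext t
        simp only [ext_smul, potential_smul, RingHom.id_apply, Pi.smul_apply] }
  let Ψ : ((points D → 𝔽) × (classes A D → 𝔽)) →ₗ[𝔽] (D → 𝔽) :=
    { toFun := fun q e => q.1 ⟨e.1.1, fst_mem_points e.2⟩ +
        q.2 ⟨edgeClass A e.1, edgeClass_mem_classes e.2⟩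
      map_add' := fun q q' => by funext e; simp only [Prod.fst_add, Prod.snd_add, Pi.add_apply]; ring
      map_smul' := fun r q => by
        funext e
        simp only [Prod.smul_fst, Prod.smul_snd, Pi.smul_apply, smul_eq_mul, RingHom.id_apply]
        ring }
  -- If all periods over the generators vanish, the potential descends to `G ⧸ H`. Its value at
  -- points and the differences `f - p'`, constant on classes, exhibit `f` as a coboundary.
  have hker : LinearMap.ker Φ ≤ LinearMap.range Ψ := by
    intro f hf
    let p := potential (ext f)
    have hinv : ∀ h ∈ H, ∀ g j, ext f (g * h) j = ext f g j := by
      intro h hh g j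
      have : ((g * h : CoprodI A) : CoprodI A ⧸ H) = (g : CoprodI A ⧸ H) := by
        rw [QuotientGroup.eq]; simpa using hh
      simp only [ext, this]
    have hpH : ∀ h ∈ H, p h = 0 := by
      intro h hh
      have hle : Subgroup.closure (T : Set (CoprodI A)) ≤ H := hT.le
      rw [← hT] at hh
      induction hh using Subgroup.closure_induction with
      | mem t ht => exact congrFun (LinearMap.mem_ker.1 hf) ⟨t, ht⟩
      | one => exact potential_one _
      | mul a b ha hb iha ihb =>
        rw [show p (a * b) = p a + p b from potential_mul_of_invariant (hinv b (hle hb)) a, iha, ihb,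
          add_zero]
      | inv a ha iha =>
        have := potential_mul_of_invariant (hinv a (hle ha)) a⁻¹
        rw [inv_mul_cancel, potential_one] at this
        have h2 : potential (ext f) a = 0 := iha
        rw [h2, add_zero] at this
        exact this.symm
    have hpmul : ∀ h ∈ H, ∀ g, p (g * h) = p g := by
      intro h hh g
      rw [show p (g * h) = p g + p h from potential_mul_of_invariant (hinv h hh) g, hpH h hh, add_zero]
    let p' : CoprodI A ⧸ H → 𝔽 := fun x => p x.out
    have hp' : ∀ g : CoprodI A, p' g = p g := by
      intro g
      obtain ⟨h, hh⟩ := QuotientGroup.mk_out_eq_mul H g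
      simp only [p', hh]
      exact hpmul h h.2 g
    have hstep : ∀ (e e' : D), edgeClass A e.1 = edgeClass A e'.1 →
        f e - p' e.1.1 = f e' - p' e'.1.1 := by
      rintro ⟨⟨x, i⟩, he⟩ ⟨⟨y, j⟩, he'⟩ h
      obtain ⟨rfl, a, rfl⟩ := edgeClass_eq_iff.1 h
      induction x using QuotientGroup.induction_on with
      | H g =>
        have h1 := potential_of_mul (ext f) a g
        have h2 : ext f g i = f ⟨_, he⟩ := dif_pos he
        have h3 : ext f (of a * g) i = f ⟨_, he'⟩ := dif_pos he'
        have h4 : p' (of a • (g : CoprodI A ⧸ H)) = p (of a * g) := hp' (of a * g)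
        rw [h2, h3] at h1
        simp only [hp', h4, p, h1]
        ring
    have hex : ∀ c : classes A D, ∃ e : D, edgeClass A e.1 = c.1 := by
      rintro ⟨c, hc⟩
      obtain ⟨e, he, rfl⟩ := mem_classes.1 hc
      exact ⟨⟨e, he⟩, rfl⟩
    choose r hr using hex
    refine ⟨(fun x => p' x.1, fun c => f (r c) - p' (r c).1.1), ?_⟩
    funext e
    have := hstep (r ⟨edgeClass A e.1, edgeClass_mem_classes e.2⟩) e (hr _)
    simp only [Ψ, LinearMap.coe_mk, AddHom.coe_mk, this]
    ring
  -- The constant pair `(1, -1)` is the source of the `+ 1` in the statement.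
  have hΨker : 0 < Module.finrank 𝔽 (LinearMap.ker Ψ) := by
    rw [Module.finrank_pos_iff_exists_ne_zero]
    refine ⟨⟨(1, -1), ?_⟩, ?_⟩
    · rw [LinearMap.mem_ker]
      funext e
      simp [Ψ]
    · intro h
      obtain ⟨e, he⟩ := hD
      have h1 := congrArg Subtype.val h
      have h2 := congrFun (congrArg Prod.fst h1) ⟨e.1, fst_mem_points he⟩
      simp at h2
  have e1 := LinearMap.finrank_range_add_finrank_ker Ψ
  have e2 := LinearMap.finrank_range_add_finrank_ker Φ
  have e3 := Submodule.finrank_mono hker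
  have e4 := Submodule.finrank_le (LinearMap.range Φ)
  simp only [Module.finrank_prod, Module.finrank_fintype_fun_eq_card, Fintype.card_coe] at e1 e2 e4
  omega

end Graph

end FreeProductRank

namespace FreeProductRank

open Monoid Monoid.CoprodI

/-! ### Linked graphs and the removal of leaves. -/

section Linked

variable {J : Type*} {A : J → Type*} [∀ j, Group (A j)]
variable {X : Type*} [MulAction (CoprodI A) X]

variable (A) in
/-- Any two points of `D`, with an element that moves one to the other, are joined in `D` by a
path that represents this element. -/
def Linked (D : Set (X × J)) : Prop :=
  ∀ (x : X) (g : CoprodI A), (∃ j, (x, j) ∈ D) → (∃ j, (g • x, j) ∈ D) → Reach D x g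

variable (A X) in
/-- The factors of the free product act freely. -/
def FactorsActFreely : Prop := ∀ (j : J) (a : A j) (x : X), of a • x = x → a = 1

variable (A) in
/-- Every point and every class of edges of `D` belongs to two edges, if it belongs to one. -/
def Leafless (D : Set (X × J)) : Prop :=
  ∀ x j, (x, j) ∈ D → (∃ i, i ≠ j ∧ (x, i) ∈ D) ∧ ∃ a : A j, a ≠ 1 ∧ (of a • x, j) ∈ D

/-- The second clause keeps every edge reachable from `x₀`, so that unions of such sets stay
connected. -/
lemma exists_finset_reach (x₀ : X) (g : CoprodI A) : ∃ D : Finset (X × J), Reach (D : Set (X × J)) x₀ g ∧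
    ∀ e ∈ D, ∃ u : CoprodI A, u • x₀ = e.1 ∧ Reach (D : Set (X × J)) x₀ u := by
  classical
  induction g using CoprodI.induction_left with
  | one => exact ⟨∅, .one, by simp⟩
  | @mul j a g ih =>
    obtain ⟨D, hD, hb⟩ := ih
    have hsub : (D : Set (X × J)) ⊆ ((insert (g • x₀, j) (insert ((of a * g) • x₀, j) D) :
        Finset (X × J)) : Set (X × J)) := by
      intro e he; simp [Finset.mem_coe.1 he]
    have h2 := Reach.step a (hD.mono hsub) (by simp) (by simp)
    refine ⟨_, h2, ?_⟩
    intro e he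
    simp only [Finset.mem_insert] at he
    rcases he with rfl | rfl | he
    · exact ⟨g, rfl, hD.mono hsub⟩
    · exact ⟨_, rfl, h2⟩
    · obtain ⟨u, hu, hr⟩ := hb e he
      exact ⟨u, hu, hr.mono hsub⟩

/-- If `H` is finitely generated then every finite set of edges in `G ⧸ H` lies in a finite
linked one. -/
lemma exists_linked_superset {H : Subgroup (CoprodI A)} {T : Finset (CoprodI A)}
    (hT : Subgroup.closure (T : Set (CoprodI A)) = H) (P : Finset ((CoprodI A ⧸ H) × J)) :
    ∃ D : Finset ((CoprodI A ⧸ H) × J), P ⊆ D ∧ Linked A (D : Set ((CoprodI A ⧸ H) × J)) := by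
  classical
  set x₀ : CoprodI A ⧸ H := ((1 : CoprodI A) : CoprodI A ⧸ H) with hx₀
  have hsm : ∀ g : CoprodI A, g • x₀ = (g : CoprodI A ⧸ H) := by
    intro g; rw [hx₀, MulAction.Quotient.smul_coe, smul_eq_mul, mul_one]
  choose D hD hb using exists_finset_reach (A := A) x₀
  set E := T.biUnion D ∪ P.biUnion fun e => insert e (D e.1.out) with hE
  have h1 : ∀ t ∈ T, (D t : Set ((CoprodI A ⧸ H) × J)) ⊆ E := by
    intro t ht
    rw [Finset.coe_subset]
    exact (Finset.subset_biUnion_of_mem D ht).trans Finset.subset_union_left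
  have h2 : ∀ e ∈ P, insert e (D e.1.out) ⊆ E := fun e he =>
    (Finset.subset_biUnion_of_mem (fun e : (CoprodI A ⧸ H) × J => insert e (D e.1.out)) he).trans
      Finset.subset_union_right
  have h3 : ∀ e ∈ P, (D e.1.out : Set ((CoprodI A ⧸ H) × J)) ⊆ E := by
    intro e he
    rw [Finset.coe_subset]
    exact (Finset.subset_insert _ _).trans (h2 e he)
  have hbase : ∀ e ∈ E, ∃ u : CoprodI A, u • x₀ = e.1 ∧ Reach (E : Set ((CoprodI A ⧸ H) × J)) x₀ u := by
    intro e he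
    rw [hE, Finset.mem_union, Finset.mem_biUnion, Finset.mem_biUnion] at he
    rcases he with ⟨t, ht, he⟩ | ⟨f, hf, he⟩
    · obtain ⟨u, hu, hr⟩ := hb t e he
      exact ⟨u, hu, hr.mono (h1 t ht)⟩
    · rw [Finset.mem_insert] at he
      rcases he with rfl | he
      · exact ⟨e.1.out, by rw [hsm]; exact QuotientGroup.out_eq' _, (hD _).mono (h3 e hf)⟩
      · obtain ⟨u, hu, hr⟩ := hb _ e he
        exact ⟨u, hu, hr.mono (h3 f hf)⟩
  have hfix : ∀ h ∈ H, h • x₀ = x₀ := by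
    intro h hh
    rw [hsm, hx₀, QuotientGroup.eq]
    simpa using hh
  have hH : ∀ h ∈ H, Reach (E : Set ((CoprodI A ⧸ H) × J)) x₀ h := by
    intro h hh
    rw [← hT] at hh
    induction hh using Subgroup.closure_induction with
    | mem t ht => exact (hD t).mono (h1 t ht)
    | one => exact .one
    | mul a b ha hb iha ihb =>
      refine ihb.trans ?_
      rwa [hfix b (hT.le hb)]
    | inv a ha iha =>
      have := iha.symm
      rwa [hfix a (hT.le ha)] at this
  refine ⟨E, fun e he => h2 e he (Finset.mem_insert_self _ _), ?_⟩
  rintro x g ⟨j, hj⟩ ⟨j', hj'⟩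
  obtain ⟨u, hu, hr⟩ := hbase _ hj
  obtain ⟨u', hu', hr'⟩ := hbase _ hj'
  simp only at hu hu'
  -- Route `g` through the base point: back along `u`, around a loop in `H`, then out along `u'`.
  have hw : u'⁻¹ * g * u ∈ H := by
    have : ((u' : CoprodI A) : CoprodI A ⧸ H) = ((g * u : CoprodI A) : CoprodI A ⧸ H) := by
      rw [← hsm, ← hsm, hu', mul_smul, hu]
    rw [QuotientGroup.eq] at this
    rwa [mul_assoc]
  have e1 := hr.symm
  rw [hu] at e1
  have e2 : Reach (E : Set ((CoprodI A ⧸ H) × J)) (u⁻¹ • x) (u'⁻¹ * g * u) := by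
    rw [← hu, inv_smul_smul]; exact hH _ hw
  have e3 := e1.trans e2
  have e4 : Reach (E : Set ((CoprodI A ⧸ H) × J)) ((u'⁻¹ * g * u * u⁻¹) • x) u' := by
    rw [show u'⁻¹ * g * u * u⁻¹ = u'⁻¹ * g by group, mul_smul, ← hu', inv_smul_smul]
    exact hr'
  have e5 := e3.trans e4
  rwa [show u' * (u'⁻¹ * g * u * u⁻¹) = g by group] at e5

/-- A path that enters the leaf `x` does so through the class of `(x, j)` and must leave through it,
so the two steps merge into one within that class. The auxiliary `b` steps back off `x`. -/
lemma Linked.diff_singleton_of_point {D : Set (X × J)} (hD : Linked A D) {x : X} {j : J}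
    (hleaf : ∀ i, (x, i) ∈ D → i = j) : Linked A (D \ {(x, j)}) := by
  have hmem : ∀ {y i}, y ≠ x → (y, i) ∈ D → (y, i) ∈ D \ {(x, j)} := by
    intro y i hy h
    exact ⟨h, fun h' => hy (congrArg Prod.fst h')⟩
  have key : ∀ (y : X) (g : CoprodI A), y ≠ x → Reach D y g →
      (g • y ≠ x → Reach (D \ {(x, j)}) y g) ∧ (g • y = x → ∃ b : A j, (of b * g) • y ≠ x ∧
        ((of b * g) • y, j) ∈ D ∧ Reach (D \ {(x, j)}) y (of b * g)) := by
    intro y g hy hg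
    induction hg with
    | one => exact ⟨fun _ => .one, fun h => absurd (by simpa using h) hy⟩
    | @step g i a hg h1 h2 ih =>
      by_cases hz : g • y = x
      · obtain ⟨b, hb1, hb2, hb3⟩ := ih.2 hz
        obtain rfl : i = j := hleaf i (hz ▸ h1)
        have e : of (a * b⁻¹) * (of b * g) = of a * g := by simp [mul_assoc]
        refine ⟨fun h => ?_, fun h => ⟨b * a⁻¹, ?_⟩⟩
        · rw [← e] at h2 h ⊢
          exact .step _ hb3 (hmem hb1 hb2) (hmem h h2)
        · have e' : of (b * a⁻¹) * (of a * g) = of b * g := by simp [mul_assoc]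
          rw [e']
          exact ⟨hb1, hb2, hb3⟩
      · have ih1 := ih.1 hz
        refine ⟨fun h => .step _ ih1 (hmem hz h1) (hmem h h2), fun h => ?_⟩
        obtain rfl : i = j := hleaf i (h ▸ h2)
        refine ⟨a⁻¹, ?_⟩
        have e' : of (a⁻¹) * (of a * g) = g := by simp
        rw [e']
        exact ⟨hz, h1, ih1⟩
  rintro y g ⟨i, hi⟩ ⟨i', hi'⟩
  have hne : ∀ {z k}, (z, k) ∈ D \ {(x, j)} → z ≠ x := by
    rintro z k hz rfl
    have := hleaf k hz.1
    exact hz.2 (by rw [this]; rfl)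
  exact (key y g (hne hi) (hD y g ⟨i, hi.1⟩ ⟨i', hi'.1⟩)).1 (hne hi')

/-- When `(x, j)` is alone in its class, every step of a path that uses it is by the trivial letter
and can be omitted. -/
lemma Linked.diff_singleton_of_class {D : Set (X × J)} (hD : Linked A D) {x : X} {j : J}
    (hx : (x, j) ∈ D) (hleaf : ∀ a : A j, (of a • x, j) ∈ D → a = 1) :
    Linked A (D \ {(x, j)}) := by
  rintro y g ⟨i, hi⟩ ⟨i', hi'⟩
  have hg := hD y g ⟨i, hi.1⟩ ⟨i', hi'.1⟩
  clear hi hi'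
  induction hg with
  | one => exact .one
  | @step g k a hg h1 h2 ih =>
    by_cases ha : a = 1
    · subst ha; simpa using ih
    refine .step a ih ⟨h1, fun h => ?_⟩ ⟨h2, fun h => ?_⟩
    · obtain ⟨rfl, rfl⟩ := Prod.ext_iff.1 h
      exact ha (hleaf a (by simpa [mul_smul] using h2))
    · obtain ⟨h3, rfl⟩ := Prod.ext_iff.1 h
      simp only at h3
      apply ha
      rw [← inv_eq_one]
      apply hleaf
      rw [← h3]
      simpa [mul_smul] using h1

lemma eq_one_of_reach_singleton (hf : FactorsActFreely A X) {x : X} {j : J} {g : CoprodI A}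
    (hg : Reach {(x, j)} x g) : g = 1 := by
  induction hg with
  | one => rfl
  | @step g k a hg h1 h2 ih =>
    subst ih
    obtain ⟨h3, rfl⟩ := Prod.ext_iff.1 h2
    have := hf _ a x (by simpa using h3)
    simp [this]

/-- Pruning of a finite linked graph. -/
lemma Linked.exists_leafless (hf : FactorsActFreely A X) {D : Finset (X × J)} (hne : D.Nonempty)
    (hD : Linked A (D : Set (X × J)))
    (hst : ∀ e ∈ D, ∃ g : CoprodI A, g ≠ 1 ∧ g • e.1 = e.1) :
    ∃ M ⊆ D, M.Nonempty ∧ Linked A (M : Set (X × J)) ∧ Leafless A (M : Set (X × J)) ∧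
      ∀ E : Set (X × J), Leafless A E → E ⊆ D → E ⊆ M := by
  classical
  induction hn : D.card using Nat.strong_induction_on generalizing D with
  | _ n ih =>
    by_cases hl : Leafless A (D : Set (X × J))
    · exact ⟨D, subset_rfl, hne, hD, hl, fun E _ h => h⟩
    have : ∃ x j, (x, j) ∈ D ∧ Linked A ((D : Set (X × J)) \ {(x, j)}) ∧
        ∀ E : Set (X × J), Leafless A E → E ⊆ D → (x, j) ∉ E := by
      unfold Leafless at hl
      push Not at hl
      obtain ⟨x, j, hx, hl⟩ := hl
      refine ⟨x, j, hx, ?_⟩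
      by_cases h : ∃ i, i ≠ j ∧ (x, i) ∈ (D : Set (X × J))
      · have h1 := hl h
        refine ⟨hD.diff_singleton_of_class hx fun a ha => ?_, fun E hE hED hxE => ?_⟩
        · by_contra h2; exact h1 a h2 ha
        · obtain ⟨a, ha, ha'⟩ := (hE x j hxE).2
          exact h1 a ha (hED ha')
      · push Not at h
        refine ⟨hD.diff_singleton_of_point fun i hi => ?_, fun E hE hED hxE => ?_⟩
        · by_contra h2; exact h i h2 hi
        · obtain ⟨i, hi, hi'⟩ := (hE x j hxE).1
          exact h i hi (hED hi')
    obtain ⟨x, j, hx, hlk, hmax⟩ := this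
    rw [← Finset.coe_erase] at hlk
    -- Pruning never reaches the empty graph: a single edge carries only the trivial element, while
    -- points have nontrivial stabilizers.
    have hne' : (D.erase (x, j)).Nonempty := by
      rw [Finset.nonempty_iff_ne_empty]
      intro h0
      rw [Finset.erase_eq_empty_iff] at h0
      rcases h0 with h0 | h0
      · simp [h0] at hne
      · obtain ⟨g, hg, hgx⟩ := hst _ hx
        simp only at hgx
        apply hg
        apply eq_one_of_reach_singleton hf (x := x) (j := j)
        have := hD x g ⟨j, hx⟩ ⟨j, by rw [hgx]; exact hx⟩
        rwa [h0, Finset.coe_singleton] at this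
    obtain ⟨M, hM, h1, h2, h3, h4⟩ := ih _ (by rw [← hn]; exact Finset.card_erase_lt_of_mem hx) hne' hlk
      (fun e he => hst e (Finset.mem_of_mem_erase he)) rfl
    refine ⟨M, hM.trans (Finset.erase_subset _ _), h1, h2, h3, fun E hE hED => h4 E hE ?_⟩
    rw [Finset.coe_erase]
    exact Set.subset_sdiff_singleton hED (hmax E hE hED)

end Linked

/-! ### Generators of stabilizers from spanning trees. -/

section SpanningTree

open Finset

/-- A stabilizer is generated by the labels of the edges outside a spanning tree of a connected
labelled graph. -/
lemma exists_closure_eq_stabilizer {G X ι : Type*} [Group G] [MulAction G X] {x₀ : X}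
    {T : Finset ι} {s t : ι → X} {c : ι → G} (hc : ∀ e ∈ T, c e • s e = t e) {V : Finset X}
    (hx₀ : x₀ ∈ V) (horb : ∀ v ∈ V, ∃ g : G, g • x₀ = v) (hs : ∀ e ∈ T, s e ∈ V)
    (ht : ∀ e ∈ T, t e ∈ V)
    (hconn : ∀ Q : G → Prop, Q 1 → (∀ e ∈ T, ∀ g, g • x₀ = s e → Q g → Q (c e * g)) →
      (∀ e ∈ T, ∀ g, g • x₀ = t e → Q g → Q ((c e)⁻¹ * g)) → ∀ g, g • x₀ ∈ V → Q g) :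
    ∃ R : Finset G, Subgroup.closure (R : Set G) = MulAction.stabilizer G x₀ ∧ #R + #V ≤ #T + 1 := by
  classical
  -- Trees are grown one vertex at a time; `γ w` is the label of the tree path from `x₀` to `w`.
  have tree : ∀ k, 1 ≤ k → k ≤ #V → ∃ W ⊆ V, #W = k ∧ x₀ ∈ W ∧ ∃ γ : X → G, γ x₀ = 1 ∧
      (∀ w ∈ W, γ w • x₀ = w) ∧ ∃ T' ⊆ T, #T' = k - 1 ∧
      ∀ e ∈ T', s e ∈ W ∧ t e ∈ W ∧ c e * γ (s e) = γ (t e) := by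
    intro k hk
    induction k, hk using Nat.le_induction with
    | base =>
      intro _
      refine ⟨{x₀}, by simpa using hx₀, by simp, by simp, fun _ => 1, rfl, by simp, ∅, by simp,
        by simp, by simp⟩
    | succ k hk ih =>
      intro hkV
      obtain ⟨W, hWV, hWk, hxW, γ, hγ0, hγ, T', hT', hT'k, hT'W⟩ := ih (by omega)
      have hex : ∃ e ∈ T, (s e ∈ W ∧ t e ∉ W) ∨ (s e ∉ W ∧ t e ∈ W) := by
        by_contra! hno
        have hall := hconn (fun g => g • x₀ ∈ W) (by simpa using hxW)
          (fun e he g hg hQ => by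
            rw [mul_smul, hg, hc e he]
            exact (hno e he).1 (hg ▸ hQ))
          (fun e he g hg hQ => by
            rw [mul_smul, hg, ← hc e he, inv_smul_smul]
            by_contra h
            exact (hno e he).2 h (hg ▸ hQ))
        have : V ⊆ W := by
          intro v hv
          obtain ⟨g, rfl⟩ := horb v hv
          exact hall g hv
        have := card_le_card this
        omega
      have ext : ∀ (e : ι) (y : X) (g : G), e ∈ T → y ∈ V → y ∉ W → g • x₀ = y →
          (s e ∈ insert y W ∧ t e ∈ insert y W) → (s e = y ∨ t e = y) →
          c e * Function.update γ y g (s e) = Function.update γ y g (t e) →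
          ∃ W ⊆ V, #W = k + 1 ∧ x₀ ∈ W ∧ ∃ γ : X → G, γ x₀ = 1 ∧
          (∀ w ∈ W, γ w • x₀ = w) ∧ ∃ T' ⊆ T, #T' = k + 1 - 1 ∧
          ∀ e ∈ T', s e ∈ W ∧ t e ∈ W ∧ c e * γ (s e) = γ (t e) := by
        intro e y g he hyV hyW hgy hmem hor heq
        have hne : ∀ w ∈ W, w ≠ y := fun w hw h => hyW (h ▸ hw)
        have heT' : e ∉ T' := by
          intro h
          have := hT'W e h
          rcases hor with h | h
          · exact hne _ this.1 h
          · exact hne _ this.2.1 h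
        refine ⟨insert y W, insert_subset hyV hWV, by rw [card_insert_of_notMem hyW, hWk],
          mem_insert_of_mem hxW, Function.update γ y g, ?_, ?_, insert e T',
          insert_subset he hT', ?_, ?_⟩
        · rw [Function.update_of_ne (hne _ hxW), hγ0]
        · intro w hw
          rw [mem_insert] at hw
          rcases hw with rfl | hw
          · simpa using hgy
          · rw [Function.update_of_ne (hne _ hw), hγ w hw]
        · rw [card_insert_of_notMem heT', hT'k]; omega
        · intro f hf
          rw [mem_insert] at hf
          rcases hf with rfl | hf
          · exact ⟨hmem.1, hmem.2, heq⟩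
          · obtain ⟨f1, f2, f3⟩ := hT'W f hf
            refine ⟨mem_insert_of_mem f1, mem_insert_of_mem f2, ?_⟩
            rw [Function.update_of_ne (hne _ f1), Function.update_of_ne (hne _ f2), f3]
      obtain ⟨e, he, ⟨h1, h2⟩ | ⟨h1, h2⟩⟩ := hex
      · have hne : s e ≠ t e := fun h => h2 (h ▸ h1)
        exact ext e (t e) (c e * γ (s e)) he (ht e he) h2 (by rw [mul_smul, hγ _ h1, hc e he])
          ⟨mem_insert_of_mem h1, mem_insert_self _ _⟩ (Or.inr rfl)
          (by rw [Function.update_of_ne hne, Function.update_self])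
      · have hne : t e ≠ s e := fun h => h1 (h ▸ h2)
        exact ext e (s e) ((c e)⁻¹ * γ (t e)) he (hs e he) h1
          (by rw [mul_smul, hγ _ h2, ← hc e he, inv_smul_smul])
          ⟨mem_insert_self _ _, mem_insert_of_mem h2⟩ (Or.inl rfl)
          (by rw [Function.update_of_ne hne, Function.update_self, mul_inv_cancel_left])
  obtain ⟨W, hWV, hWk, -, γ, hγ0, hγ, T', hT', hT'k, hT'W⟩ :=
    tree #V (card_pos.2 ⟨x₀, hx₀⟩) le_rfl
  obtain rfl := eq_of_subset_of_card_le hWV hWk.ge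
  have hVpos : 0 < #W := card_pos.2 ⟨x₀, hx₀⟩
  refine ⟨(T \ T').image fun e => (γ (t e))⁻¹ * (c e * γ (s e)), ?_, ?_⟩
  · set N := Subgroup.closure (((T \ T').image fun e => (γ (t e))⁻¹ * (c e * γ (s e)) : Finset G) : Set G)
    have hgen : ∀ e ∈ T, (γ (t e))⁻¹ * (c e * γ (s e)) ∈ N := by
      intro e he
      by_cases h : e ∈ T'
      · rw [(hT'W e h).2.2, inv_mul_cancel]; exact N.one_mem
      · exact Subgroup.subset_closure (mem_coe.2 (mem_image_of_mem _ (mem_sdiff.2 ⟨he, h⟩)))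
    apply le_antisymm
    · rw [Subgroup.closure_le]
      intro g hg
      obtain ⟨e, he, rfl⟩ := mem_image.1 (mem_coe.1 hg)
      have he := (mem_sdiff.1 he).1
      change _ • x₀ = x₀
      rw [mul_smul, mul_smul, hγ _ (hs e he), hc e he, inv_smul_eq_iff, hγ _ (ht e he)]
    · intro g hg
      have hg : g • x₀ = x₀ := hg
      -- The invariant says that closing a path up along the tree gives an element of `N`; at `g •
      -- x₀ = x₀` this is `g ∈ N`.
      have := hconn (fun g => (γ (g • x₀))⁻¹ * g ∈ N) (by simp [hγ0])
        (fun e he g hg hQ => by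
          have h := N.mul_mem (hgen e he) (hg ▸ hQ)
          rw [mul_smul, hg, hc e he]
          simpa [mul_assoc] using h)
        (fun e he g hg hQ => by
          have h := N.mul_mem (N.inv_mem (hgen e he)) (hg ▸ hQ)
          rw [mul_smul, hg, ← hc e he, inv_smul_smul]
          simpa [mul_assoc] using h) g (by rwa [hg])
      simpa [hg, hγ0] using this
  · have h1 : #((T \ T').image fun e => (γ (t e))⁻¹ * (c e * γ (s e))) ≤ #(T \ T') := card_image_le
    have h2 := card_sdiff_of_subset hT'
    have h3 := card_le_card hT'
    omega

variable {J : Type*} {A : J → Type*} [∀ j, Group (A j)]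
variable {X : Type*} [MulAction (CoprodI A) X]

/-- The stabilizer of a point of a finite linked graph is generated by at most as many elements
as the first Betti number of the graph. -/
lemma Linked.exists_closure_eq_stabilizer (hf : FactorsActFreely A X) {D : Finset (X × J)}
    (hD : Linked A (D : Set (X × J))) {x₀ : X} (hx₀ : x₀ ∈ points D)
    (horb : ∀ x ∈ points D, ∃ g : CoprodI A, g • x₀ = x) :
    ∃ R : Finset (CoprodI A), Subgroup.closure (R : Set (CoprodI A)) =
      MulAction.stabilizer (CoprodI A) x₀ ∧ #R + #(points D) + #(classes A D) ≤ #D + 1 := by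
  classical
  have hρ : ∀ c : Set X × J, ∃ r : X × J, c ∈ classes A D → r ∈ D ∧ edgeClass A r = c := by
    intro c
    by_cases h : c ∈ classes A D
    · obtain ⟨r, hr⟩ := mem_classes.1 h
      exact ⟨r, fun _ => hr⟩
    · exact ⟨((x₀, c.2)), fun h' => absurd h' h⟩
  choose ρ hρ using hρ
  have hρ1 : ∀ e ∈ D, ρ (edgeClass A e) ∈ D := fun e he => (hρ _ (edgeClass_mem_classes he)).1
  have hρ2 : ∀ e ∈ D, edgeClass A (ρ (edgeClass A e)) = edgeClass A e :=
    fun e he => (hρ _ (edgeClass_mem_classes he)).2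
  have hc : ∀ e : X × J, ∃ a : A e.2, e ∈ D → of a • (ρ (edgeClass A e)).1 = e.1 := by
    intro e
    by_cases he : e ∈ D
    · obtain ⟨_, a, ha⟩ := edgeClass_eq_iff.1 (hρ2 e he)
      exact ⟨a, fun _ => ha.symm⟩
    · exact ⟨1, fun h => absurd h he⟩
  choose α hα using hc
  -- Each class is replaced by a star from its representative edge `ρ` to its other edges. This
  -- leaves `#D - #classes` edges on the points alone.
  set T := D.filter fun e => ρ (edgeClass A e) ≠ e with hTdef
  have hT : ∀ e ∈ T, e ∈ D := fun e he => (mem_filter.1 he).1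
  have hcard : #T + #(classes A D) ≤ #D := by
    have h1 : #(classes A D) ≤ #(D.filter fun e => ¬ ρ (edgeClass A e) ≠ e) := by
      apply card_le_card_of_injOn ρ
      · intro c hc
        have := hρ c hc
        rw [coe_filter]
        refine ⟨this.1, ?_⟩
        rw [this.2]; simp
      · intro c hc c' hc' h
        rw [← (hρ c hc).2, ← (hρ c' hc').2, h]
    have h2 : #T + #(D.filter fun e => ¬ ρ (edgeClass A e) ≠ e) = #D :=
      card_filter_add_card_filter_not _
    omega
  obtain ⟨R, hR, hRc⟩ := FreeProductRank.exists_closure_eq_stabilizer (G := CoprodI A) (x₀ := x₀) (T := T)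
    (s := fun e => (ρ (edgeClass A e)).1) (t := fun e => e.1) (c := fun e => of (α e))
    (fun e he => hα e (hT e he)) hx₀ horb
    (fun e he => fst_mem_points (hρ1 e (hT e he))) (fun e he => fst_mem_points (hT e he)) (by
      intro Q h1 hfwd hbwd
      have hone : ∀ e ∈ D, ρ (edgeClass A e) = e → (of (α e) : CoprodI A) = 1 := by
        intro e he h
        have := hα e he
        rw [h] at this
        rw [hf _ _ _ this, map_one]
      have hfwd' : ∀ e ∈ D, ∀ g, g • x₀ = (ρ (edgeClass A e)).1 → Q g → Q (of (α e) * g) := by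
        intro e he g hg hQ
        by_cases h : ρ (edgeClass A e) = e
        · rwa [hone e he h, one_mul]
        · exact hfwd e (mem_filter.2 ⟨he, h⟩) g hg hQ
      have hbwd' : ∀ e ∈ D, ∀ g, g • x₀ = e.1 → Q g → Q ((of (α e))⁻¹ * g) := by
        intro e he g hg hQ
        by_cases h : ρ (edgeClass A e) = e
        · rwa [hone e he h, inv_one, one_mul]
        · exact hbwd e (mem_filter.2 ⟨he, h⟩) g hg hQ
      intro g hg
      obtain ⟨j₀, hj₀⟩ := mem_points.1 hx₀
      obtain ⟨j₁, hj₁⟩ := mem_points.1 hg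
      have hr := hD x₀ g ⟨j₀, hj₀⟩ ⟨j₁, hj₁⟩
      clear hg hj₁
      induction hr with
      | one => exact h1
      | @step g j a hg e1 e2 ih =>
        have e1' : (g • x₀, j) ∈ D := e1
        have e2' : ((of a * g) • x₀, j) ∈ D := e2
        have hcl : edgeClass A (g • x₀, j) = edgeClass A ((of a * g) • x₀, j) :=
          edgeClass_eq_iff.2 ⟨rfl, a, mul_smul _ _ _⟩
        have f1 := hα _ e1'
        have f2 := hα _ e2'
        rw [← hcl] at f2
        have q1 := hbwd' _ e1' g rfl ih
        have q2 := hfwd' _ e2' _ (by rw [← hcl, mul_smul, inv_smul_eq_iff]; exact f1.symm) q1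
        -- A step inside a class factors through its representative; freeness of the action makes
        -- the labels agree, and not only the endpoints.
        have hfix : (α ((of a * g) • x₀, j))⁻¹ * (a * α (g • x₀, j)) = 1 := by
          apply hf j _ (ρ (edgeClass A (g • x₀, j))).1
          rw [map_mul, map_mul, map_inv, mul_smul (of (α ((of a * g) • x₀, j)))⁻¹, inv_smul_eq_iff, f2,
            mul_smul (of a) (of (α (g • x₀, j))), f1, mul_smul]
        have hae : of a = of (α ((of a * g) • x₀, j)) * (of (α (g • x₀, j)) : CoprodI A)⁻¹ := by
          rw [inv_mul_eq_one] at hfix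
          rw [hfix, map_mul, mul_inv_cancel_right]
        rw [hae, mul_assoc]
        exact q2)
  exact ⟨R, hR, by omega⟩

end SpanningTree

end FreeProductRank

namespace FreeProductRank

open Monoid Monoid.CoprodI Finset
open scoped Pointwise

/-! ### Degree sums and Euler characteristics in fibre products. -/

section Count

variable {J : Type*} {A : J → Type*} [∀ j, Group (A j)]
variable {X Y : Type*} [MulAction (CoprodI A) X] [MulAction (CoprodI A) Y]

open Classical in
/-- The number of edges of `D` at the point `x`. -/
noncomputable def pointDegree {X : Type*} (D : Finset (X × J)) (x : X) : ℕ := #{e ∈ D | e.1 = x}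

variable (A) in
open Classical in
/-- The number of edges of `D` in the class `c`. -/
noncomputable def classDegree (D : Finset (X × J)) (c : Set X × J) : ℕ :=
  #{e ∈ D | edgeClass A e = c}

variable (A) in
/-- Minus the Euler characteristic of the graph `D`. -/
noncomputable def negEuler (D : Finset (X × J)) : ℤ := #D - #(points D) - #(classes A D)

lemma sum_pointDegree {X : Type*} (D : Finset (X × J)) :
    ∑ x ∈ points D, ((pointDegree D x : ℤ) - 2) = #D - 2 * #(points D) := by
  classical
  have h : ∑ x ∈ points D, pointDegree D x = #D := by
    rw [card_eq_sum_card_fiberwise (s := D) (f := Prod.fst) (t := points D)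
      (fun e he => fst_mem_points he)]
    exact sum_congr rfl fun x _ => by unfold pointDegree; congr
  rw [sum_sub_distrib, ← Nat.cast_sum, h]
  simp [mul_comm]

lemma sum_classDegree (D : Finset (X × J)) :
    ∑ c ∈ classes A D, ((classDegree A D c : ℤ) - 2) = #D - 2 * #(classes A D) := by
  classical
  rw [sum_sub_distrib, ← Nat.cast_sum]
  unfold classDegree
  rw [← card_eq_sum_card_fiberwise (fun e he => edgeClass_mem_classes he)]
  simp [mul_comm]

/-- Every edge has one end at a point and one at a class, so each of the two degree sums counts all
edges. -/
lemma two_mul_negEuler (D : Finset (X × J)) : 2 * negEuler A D =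
    ∑ x ∈ points D, ((pointDegree D x : ℤ) - 2) +
      ∑ c ∈ classes A D, ((classDegree A D c : ℤ) - 2) := by
  rw [sum_pointDegree, sum_classDegree, negEuler]; ring

lemma two_le_pointDegree {D : Finset (X × J)} (hD : Leafless A (D : Set (X × J))) {x : X}
    (hx : x ∈ points D) : 2 ≤ pointDegree D x := by
  classical
  obtain ⟨j, hj⟩ := mem_points.1 hx
  obtain ⟨i, hi, hi'⟩ := (hD x j hj).1
  have : ({(x, j), (x, i)} : Finset (X × J)) ⊆ ({e ∈ D | e.1 = x} : Finset (X × J)) := by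
    intro e he
    simp only [mem_insert, mem_singleton] at he
    rw [mem_filter]
    rcases he with rfl | rfl
    · exact ⟨hj, rfl⟩
    · exact ⟨hi', rfl⟩
  have h2 := card_le_card this
  rw [card_pair (by simpa using hi.symm)] at h2
  exact h2

lemma two_le_classDegree (hf : FactorsActFreely A X) {D : Finset (X × J)}
    (hD : Leafless A (D : Set (X × J))) {c : Set X × J} (hc : c ∈ classes A D) :
    2 ≤ classDegree A D c := by
  classical
  obtain ⟨⟨x, j⟩, hj, rfl⟩ := mem_classes.1 hc
  obtain ⟨a, ha, ha'⟩ := (hD x j hj).2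
  have : ({(x, j), (of a • x, j)} : Finset (X × J)) ⊆
      ({e ∈ D | edgeClass A e = edgeClass A (x, j)} : Finset (X × J)) := by
    intro e he
    simp only [mem_insert, mem_singleton] at he
    rw [mem_filter]
    rcases he with rfl | rfl
    · exact ⟨hj, rfl⟩
    · exact ⟨ha', (edgeClass_eq_iff.2 ⟨rfl, a, rfl⟩).symm⟩
  have h2 := card_le_card this
  rw [card_pair] at h2
  · exact h2
  · intro h
    exact ha (hf j a x (congrArg Prod.fst h).symm)

/-- A degree in `C` is at most both degrees below it, and `min m n - 2 ≤ (m - 2) * (n - 2)` for `m,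
n ≥ 2`. -/
lemma sum_pointDegree_le {D : Finset (X × J)} {E : Finset (Y × J)} {C : Finset ((X × Y) × J)}
    (hD : Leafless A (D : Set (X × J))) (hE : Leafless A (E : Set (Y × J)))
    (hC : (C : Set ((X × Y) × J)) ⊆ fiberProd (D : Set (X × J)) (E : Set (Y × J))) :
    ∑ z ∈ points C, ((pointDegree C z : ℤ) - 2) ≤
      (∑ x ∈ points D, ((pointDegree D x : ℤ) - 2)) *
        ∑ y ∈ points E, ((pointDegree E y : ℤ) - 2) := by
  classical
  have hnn : ∀ x ∈ points D, (0 : ℤ) ≤ (pointDegree D x : ℤ) - 2 := fun x hx => by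
    have := two_le_pointDegree hD hx; omega
  have hnn' : ∀ y ∈ points E, (0 : ℤ) ≤ (pointDegree E y : ℤ) - 2 := fun y hy => by
    have := two_le_pointDegree hE hy; omega
  have hsub : points C ⊆ points D ×ˢ points E := by
    rintro ⟨x, y⟩ hz
    obtain ⟨j, hj⟩ := mem_points.1 hz
    have := hC hj
    exact mem_product.2 ⟨mem_points.2 ⟨j, this.1⟩, mem_points.2 ⟨j, this.2⟩⟩
  have hle : ∀ z ∈ points C, (pointDegree C z : ℤ) - 2 ≤
      ((pointDegree D z.1 : ℤ) - 2) * ((pointDegree E z.2 : ℤ) - 2) := by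
    rintro ⟨x, y⟩ hz
    have hxy := mem_product.1 (hsub hz)
    have h1 := hnn x hxy.1
    have h2 := hnn' y hxy.2
    have h3 : pointDegree C (x, y) ≤ pointDegree D x := by
      apply card_le_card_of_injOn (fun e => (e.1.1, e.2))
      · rintro e he
        simp only [coe_filter, Set.mem_ofPred_eq] at he ⊢
        exact ⟨(hC he.1).1, by rw [he.2]⟩
      · rintro ⟨z, i⟩ he ⟨z', i'⟩ he' h
        simp only [coe_filter, Set.mem_ofPred_eq] at he he'
        simp only [Prod.mk.injEq] at h
        rw [he.2, he'.2, h.2]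
    have h4 : pointDegree C (x, y) ≤ pointDegree E y := by
      apply card_le_card_of_injOn (fun e => (e.1.2, e.2))
      · rintro e he
        simp only [coe_filter, Set.mem_ofPred_eq] at he ⊢
        exact ⟨(hC he.1).2, by rw [he.2]⟩
      · rintro ⟨z, i⟩ he ⟨z', i'⟩ he' h
        simp only [coe_filter, Set.mem_ofPred_eq] at he he'
        simp only [Prod.mk.injEq] at h
        rw [he.2, he'.2, h.2]
    zify at h3 h4
    simp only
    rcases h1.eq_or_lt with h | h
    · rw [← h, zero_mul]; linarith
    · nlinarith
  rw [sum_mul_sum, ← sum_product' (f := fun x y => ((pointDegree D x : ℤ) - 2) *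
    ((pointDegree E y : ℤ) - 2))]
  refine (sum_le_sum hle).trans (sum_le_sum_of_subset_of_nonneg hsub fun z hz _ => ?_)
  have hxy := mem_product.1 hz
  exact mul_nonneg (hnn _ hxy.1) (hnn' _ hxy.2)

/-- The elements of the factor `A j` that move `x` to a point of an edge `(_, j)` of `D`. -/
lemma exists_finset_classDegree (hf : FactorsActFreely A X) (D : Finset (X × J)) (x : X) (j : J) :
    ∃ P : Finset (A j), (∀ a, a ∈ P ↔ (of a • x, j) ∈ D) ∧
      #P = classDegree A D (edgeClass A (x, j)) := by
  classical
  have hinj : Function.Injective (fun a : A j => (of a • x, j)) := by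
    intro a b h
    have h1 : of a • x = of b • x := congrArg Prod.fst h
    rw [← inv_smul_eq_iff, ← map_inv, ← mul_smul, ← map_mul] at h1
    exact (inv_mul_eq_one.1 (hf j _ x h1)).symm
  refine ⟨D.preimage _ hinj.injOn, fun a => by simp, ?_⟩
  rw [← card_image_of_injective _ hinj, classDegree]
  congr 1
  ext ⟨y, i⟩
  simp only [mem_image, mem_preimage, mem_filter]
  constructor
  · rintro ⟨a, ha, h⟩
    obtain ⟨rfl, rfl⟩ := Prod.ext_iff.1 h
    exact ⟨ha, (edgeClass_eq_iff.2 ⟨rfl, a, rfl⟩).symm⟩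
  · rintro ⟨hy, h⟩
    obtain ⟨rfl, a, rfl⟩ := edgeClass_eq_iff.1 h.symm
    exact ⟨a, hy, rfl⟩

/-- The classes of `C` are grouped by the pairs of classes of `D` and `E` below them; for each pair
the bound is `le_pollardSum` in the factor. -/
lemma sum_classDegree_le {u v : ℤ} (hv : 0 < v) (huv : v ≤ u)
    (hL : ∀ (j : J) (L : Subgroup (A j)), Finite L → 3 ≤ Nat.card L →
      v * Nat.card L ≤ u * (Nat.card L - 2))
    (hfX : FactorsActFreely A X) (hfY : FactorsActFreely A Y)
    {D : Finset (X × J)} {E : Finset (Y × J)} {C : Finset ((X × Y) × J)}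
    (hD : Leafless A (D : Set (X × J))) (hE : Leafless A (E : Set (Y × J)))
    (hC : (C : Set ((X × Y) × J)) ⊆ fiberProd (D : Set (X × J)) (E : Set (Y × J))) :
    v * ∑ c ∈ classes A C, ((classDegree A C c : ℤ) - 2) ≤
      u * ((∑ c ∈ classes A D, ((classDegree A D c : ℤ) - 2)) *
        ∑ c ∈ classes A E, ((classDegree A E c : ℤ) - 2)) := by
  classical
  let π : Set (X × Y) × J → (Set X × J) × (Set Y × J) := fun c =>
    ((Prod.fst '' c.1, c.2), (Prod.snd '' c.1, c.2))
  have hπ : ∀ x y j, π (edgeClass A ((x, y), j)) = (edgeClass A (x, j), edgeClass A (y, j)) := by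
    intro x y j
    simp only [π, edgeClass, ← Set.range_comp]
    rfl
  have hmaps : ∀ c ∈ classes A C, π c ∈ classes A D ×ˢ classes A E := by
    intro c hc
    obtain ⟨⟨⟨x, y⟩, j⟩, he, rfl⟩ := mem_classes.1 hc
    rw [hπ]
    have := hC he
    exact mem_product.2 ⟨edgeClass_mem_classes this.1, edgeClass_mem_classes this.2⟩
  rw [sum_mul_sum, ← sum_product', ← sum_fiberwise_of_maps_to hmaps, mul_sum, mul_sum]
  apply sum_le_sum
  rintro ⟨a, b⟩ hab
  rw [mem_product] at hab
  have hda := two_le_classDegree hfX hD hab.1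
  have hdb := two_le_classDegree hfY hE hab.2
  simp only at hda hdb ⊢
  rcases ({c ∈ classes A C | π c = (a, b)} : Finset _).eq_empty_or_nonempty with h0 | ⟨c₀, hc₀⟩
  · rw [h0, sum_empty, mul_zero]
    exact mul_nonneg (by linarith) (mul_nonneg (by linarith) (by linarith))
  rw [mem_filter] at hc₀
  obtain ⟨hc₀, hcab⟩ := hc₀
  obtain ⟨⟨⟨x, y⟩, j⟩, he, rfl⟩ := mem_classes.1 hc₀
  rw [hπ, Prod.mk.injEq] at hcab
  obtain ⟨rfl, rfl⟩ := hcab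
  obtain ⟨P, hP, hPc⟩ := exists_finset_classDegree hfX D x j
  obtain ⟨Q, hQ, hQc⟩ := exists_finset_classDegree hfY E y j
  rw [← hPc] at hda ⊢
  rw [← hQc] at hdb ⊢
  -- Classes over the chosen pair are parametrized by the relative position `k` of the two
  -- coordinates.
  have hκ : ∀ c : Set (X × Y) × J, ∃ k : A j, c ∈ ({c ∈ classes A C |
      π c = (edgeClass A (x, j), edgeClass A (y, j))} : Finset _) →
      c = edgeClass A ((x, of k • y), j) := by
    intro c
    by_cases hc : c ∈ ({c ∈ classes A C |
      π c = (edgeClass A (x, j), edgeClass A (y, j))} : Finset _)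
    · rw [mem_filter] at hc
      obtain ⟨⟨⟨x', y'⟩, i⟩, he', rfl⟩ := mem_classes.1 hc.1
      have h2 := hc.2
      rw [hπ, Prod.mk.injEq] at h2
      obtain ⟨rfl, α, rfl⟩ := edgeClass_eq_iff.1 h2.1.symm
      obtain ⟨_, β, rfl⟩ := edgeClass_eq_iff.1 h2.2.symm
      refine ⟨α⁻¹ * β, fun _ => (edgeClass_eq_iff.2 ⟨rfl, α, ?_⟩).symm⟩
      rw [Prod.smul_mk, map_mul, map_inv, mul_smul, smul_inv_smul]
    · exact ⟨1, fun h => absurd h hc⟩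
  choose κ hκ using hκ
  -- An edge of this class is given by `p ∈ P` with `p * k ∈ Q`, hence by a representation of `k` in
  -- `P⁻¹ * Q`.
  have hdeg : ∀ k : A j, classDegree A C (edgeClass A ((x, of k • y), j)) ≤ repCount P⁻¹ Q k := by
    intro k
    refine le_trans (card_le_card ?_) (card_image_le (s := {a ∈ P⁻¹ | a⁻¹ * k ∈ Q})
      (f := fun a : A j => ((of a⁻¹ • x, of (a⁻¹ * k) • y), j)))
    rintro ⟨⟨x', y'⟩, i⟩ h
    rw [mem_filter] at h
    obtain ⟨rfl, p, hp⟩ := edgeClass_eq_iff.1 h.2.symm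
    rw [Prod.smul_mk, ← mul_smul, ← map_mul, Prod.mk.injEq] at hp
    obtain ⟨rfl, rfl⟩ := hp
    have h1 := hC h.1
    refine mem_image.2 ⟨p⁻¹, ?_, by simp⟩
    rw [mem_filter, mem_inv', inv_inv]
    exact ⟨(hP p).2 h1.1, (hQ _).2 h1.2⟩
  have hmain : (∑ c ∈ classes A C with π c = (edgeClass A (x, j), edgeClass A (y, j)),
      ((classDegree A C c : ℤ) - 2)) ≤ ((∑ k ∈ P⁻¹ * Q, (repCount P⁻¹ Q k - 2) : ℕ) : ℤ) := by
    calc _ ≤ ∑ c ∈ classes A C with π c = (edgeClass A (x, j), edgeClass A (y, j)),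
          ((repCount P⁻¹ Q (κ c) - 2 : ℕ) : ℤ) := by
          apply sum_le_sum
          intro c hc
          have := hdeg (κ c)
          rw [← hκ c hc] at this
          omega
      _ ≤ _ := by
          rw [← Nat.cast_sum]
          norm_cast
          rw [← sum_image (f := fun k => repCount P⁻¹ Q k - 2) (g := κ)]
          · apply sum_le_sum_of_ne_zero
            intro k _ hk
            by_contra hn
            rw [repCount_eq_zero hn] at hk
            exact hk rfl
          · intro c hc c' hc' h
            rw [hκ c hc, hκ c' hc', h]
  have hsum := sum_repCount_sub_two P⁻¹ Q
  have hkem := le_pollardSum hv huv (hL j) (A := P⁻¹) (B := Q) (by rwa [card_inv]) hdb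
  rw [card_inv] at hsum hkem
  have hsum' : ((∑ k ∈ P⁻¹ * Q, (repCount P⁻¹ Q k - 2) : ℕ) : ℤ) = #P * #Q - pollardSum P⁻¹ Q := by
    rw [eq_sub_iff_add_eq]; exact_mod_cast hsum
  have := mul_le_mul_of_nonneg_left hmain hv.le
  rw [hsum'] at this
  linarith

/-- The main estimate for the Euler characteristic of a graph in a fibre product. -/
lemma negEuler_le {u v : ℤ} (hv : 0 < v) (huv : v ≤ u)
    (hL : ∀ (j : J) (L : Subgroup (A j)), Finite L → 3 ≤ Nat.card L →
      v * Nat.card L ≤ u * (Nat.card L - 2))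
    (hfX : FactorsActFreely A X) (hfY : FactorsActFreely A Y)
    {D : Finset (X × J)} {E : Finset (Y × J)} {C : Finset ((X × Y) × J)}
    (hD : Leafless A (D : Set (X × J))) (hE : Leafless A (E : Set (Y × J)))
    (hC : (C : Set ((X × Y) × J)) ⊆ fiberProd (D : Set (X × J)) (E : Set (Y × J))) :
    v * negEuler A C ≤ 2 * u * (negEuler A D * negEuler A E) := by
  have h1 := sum_pointDegree_le hD hE hC
  have h2 := sum_classDegree_le hv huv hL hfX hfY hD hE hC
  have hC2 := two_mul_negEuler (A := A) C
  have hD2 := two_mul_negEuler (A := A) D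
  have hE2 := two_mul_negEuler (A := A) E
  have n1 : 0 ≤ ∑ x ∈ points D, ((pointDegree D x : ℤ) - 2) :=
    sum_nonneg fun x hx => by have := two_le_pointDegree hD hx; omega
  have n2 : 0 ≤ ∑ x ∈ points E, ((pointDegree E x : ℤ) - 2) :=
    sum_nonneg fun x hx => by have := two_le_pointDegree hE hx; omega
  have n3 : 0 ≤ ∑ c ∈ classes A D, ((classDegree A D c : ℤ) - 2) :=
    sum_nonneg fun x hx => by have := two_le_classDegree hfX hD hx; omega
  have n4 : 0 ≤ ∑ c ∈ classes A E, ((classDegree A E c : ℤ) - 2) :=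
    sum_nonneg fun x hx => by have := two_le_classDegree hfY hE hx; omega
  set p := ∑ z ∈ points C, ((pointDegree C z : ℤ) - 2)
  set q := ∑ c ∈ classes A C, ((classDegree A C c : ℤ) - 2)
  set pD := ∑ x ∈ points D, ((pointDegree D x : ℤ) - 2)
  set pE := ∑ x ∈ points E, ((pointDegree E x : ℤ) - 2)
  set cD := ∑ c ∈ classes A D, ((classDegree A D c : ℤ) - 2)
  set cE := ∑ c ∈ classes A E, ((classDegree A E c : ℤ) - 2)
  have hu : 0 ≤ u := hv.le.trans huv
  have i1 : v * p ≤ u * (pD * pE) :=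
    (mul_le_mul_of_nonneg_left h1 hv.le).trans (mul_le_mul_of_nonneg_right huv (mul_nonneg n1 n2))
  have i2 : 0 ≤ u * (pD * cE) := mul_nonneg hu (mul_nonneg n1 n4)
  have i3 : 0 ≤ u * (cD * pE) := mul_nonneg hu (mul_nonneg n3 n2)
  have i4 : 2 * (v * negEuler A C) = v * p + v * q := by rw [← mul_add, ← hC2]; ring
  have i5 : 4 * (negEuler A D * negEuler A E) = (pD + cD) * (pE + cE) := by
    rw [← hD2, ← hE2]; ring
  -- The mixed terms `pD * cE` and `cD * pE` are nonnegative and dropped. The constant `2` remains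
  -- from doubling three Euler characteristics.
  nlinarith

end Count

end FreeProductRank

namespace FreeProductRank

open Monoid Monoid.CoprodI Finset

/-! ### Cores of intersections in the fibre product of cores. -/

section Intersection

variable {J : Type*} {A : J → Type*} [∀ j, Group (A j)]
variable {X Y : Type*} [MulAction (CoprodI A) X] [MulAction (CoprodI A) Y]

lemma negEuler_nonneg (hf : FactorsActFreely A X) {D : Finset (X × J)}
    (hD : Leafless A (D : Set (X × J))) : 0 ≤ negEuler A D := by
  have h := two_mul_negEuler (A := A) D
  have h1 : 0 ≤ ∑ x ∈ points D, ((pointDegree D x : ℤ) - 2) :=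
    sum_nonneg fun x hx => by have := two_le_pointDegree hD hx; omega
  have h2 : 0 ≤ ∑ c ∈ classes A D, ((classDegree A D c : ℤ) - 2) :=
    sum_nonneg fun x hx => by have := two_le_classDegree hf hD hx; omega
  linarith

lemma negEuler_biUnion {ι : Type*} [DecidableEq (X × J)] {S : Finset ι} {D : ι → Finset (X × J)}
    (h : ∀ s ∈ S, ∀ t ∈ S, s ≠ t → ∀ e ∈ D s, ∀ f ∈ D t,
      f.1 ∉ MulAction.orbit (CoprodI A) e.1) :
    negEuler A (S.biUnion D) = ∑ s ∈ S, negEuler A (D s) := by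
  classical
  have h1 : points (S.biUnion D) = S.biUnion fun s => points (D s) := by
    ext x
    simp only [mem_points, mem_biUnion]
    exact ⟨fun ⟨j, s, hs, hj⟩ => ⟨s, hs, j, hj⟩, fun ⟨s, hs, j, hj⟩ => ⟨j, s, hs, hj⟩⟩
  have h2 : classes A (S.biUnion D) = S.biUnion fun s => classes A (D s) := by
    ext c
    simp only [mem_classes, mem_biUnion]
    exact ⟨fun ⟨e, ⟨s, hs, he⟩, hc⟩ => ⟨s, hs, e, he, hc⟩,
      fun ⟨s, hs, e, he, hc⟩ => ⟨e, ⟨s, hs, he⟩, hc⟩⟩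
  unfold negEuler
  rw [h1, h2, card_biUnion, card_biUnion, card_biUnion]
  · push_cast
    rw [← sum_sub_distrib, ← sum_sub_distrib]
  · intro s hs t ht hst
    rw [Function.onFun, Finset.disjoint_left]
    intro c hc hc'
    obtain ⟨⟨x, i⟩, he, rfl⟩ := mem_classes.1 hc
    obtain ⟨⟨y, j⟩, hf, hxy⟩ := mem_classes.1 hc'
    obtain ⟨rfl, a, ha⟩ := edgeClass_eq_iff.1 hxy.symm
    exact h s hs t ht hst _ he _ hf ⟨of a, ha.symm⟩
  · intro s hs t ht hst
    rw [Function.onFun, Finset.disjoint_left]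
    intro x hx hx'
    obtain ⟨i, hi⟩ := mem_points.1 hx
    obtain ⟨j, hj⟩ := mem_points.1 hx'
    exact h s hs t ht hst _ hi _ hj (MulAction.mem_orbit_self x)
  · intro s hs t ht hst
    rw [Function.onFun, Finset.disjoint_left]
    intro e he he'
    exact h s hs t ht hst _ he _ he' (MulAction.mem_orbit_self _)

lemma Reach.restrict_orbit {D : Set (X × J)} {x : X} {g : CoprodI A} (hg : Reach D x g) {z : X}
    (hx : x ∈ MulAction.orbit (CoprodI A) z) :
    Reach {e ∈ D | e.1 ∈ MulAction.orbit (CoprodI A) z} x g := by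
  induction hg with
  | one => exact .one
  | step a _ h1 h2 ih =>
    exact .step a ih ⟨h1, (MulAction.mem_orbit_of_mem_orbit _ hx :)⟩
      ⟨h2, (MulAction.mem_orbit_of_mem_orbit _ hx :)⟩

lemma linked_fiberProd_orbit {D : Set (X × J)} {E : Set (Y × J)} (hD : Linked A D)
    (hE : Linked A E) (z : X × Y) :
    Linked A {e ∈ fiberProd D E | e.1 ∈ MulAction.orbit (CoprodI A) z} := by
  rintro ⟨x, y⟩ g ⟨j, hj, ho⟩ ⟨j', hj', -⟩
  exact ((hD x g ⟨j, hj.1⟩ ⟨j', hj'.1⟩).prod (hE y g ⟨j, hj.2⟩ ⟨j', hj'.2⟩)).restrict_orbit ho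

lemma finite_fiberProd (D : Finset (X × J)) (E : Finset (Y × J)) :
    (fiberProd (D : Set (X × J)) (E : Set (Y × J))).Finite := by
  have hinj : Function.Injective (fun e : (X × Y) × J => ((e.1.1, e.2), (e.1.2, e.2))) := by
    rintro ⟨⟨x, y⟩, j⟩ ⟨⟨x', y'⟩, j'⟩ h
    simp only [Prod.mk.injEq] at h ⊢
    tauto
  refine Set.Finite.subset (Set.Finite.preimage hinj.injOn
    ((D.finite_toSet).prod (E.finite_toSet))) ?_
  exact fun e he => ⟨he.1, he.2⟩

/-- Applied to the two projections of a fibre product, this places the core of an intersection over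
the cores of `H` and `K`. -/
lemma Leafless.map {Z : Type*} [MulAction (CoprodI A) Z] {E : Set (Z × J)} (hE : Leafless A E)
    (π : Z → X) (hπ : ∀ (g : CoprodI A) z, π (g • z) = g • π z) :
    Leafless A {e : X × J | ∃ z, π z = e.1 ∧ (z, e.2) ∈ E} := by
  rintro x j ⟨z, rfl, hz⟩
  obtain ⟨⟨i, hi, hi'⟩, a, ha, ha'⟩ := hE z j hz
  exact ⟨⟨i, hi, z, rfl, hi'⟩, a, ha, of a • z, hπ _ _, ha'⟩

lemma Leafless.biUnion {ι : Type*} [DecidableEq (X × J)] {S : Finset ι} {D : ι → Finset (X × J)}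
    (h : ∀ s ∈ S, Leafless A (D s : Set (X × J))) :
    Leafless A (S.biUnion D : Set (X × J)) := by
  intro x j hx
  rw [mem_coe, mem_biUnion] at hx
  obtain ⟨s, hs, hx⟩ := hx
  have hsub : (D s : Set (X × J)) ⊆ S.biUnion D := by
    rw [coe_subset]; exact subset_biUnion_of_mem D hs
  obtain ⟨⟨i, hi, hi'⟩, a, ha, ha'⟩ := h s hs x j hx
  exact ⟨⟨i, hi, hsub hi'⟩, a, ha, hsub ha'⟩

lemma factorsActFreely_quotient {H : Subgroup (CoprodI A)}
    (hH : ∀ (j : J) (a : A j) (g : CoprodI A), g⁻¹ * of a * g ∈ H → a = 1) :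
    FactorsActFreely A (CoprodI A ⧸ H) := by
  intro j a x h
  induction x using QuotientGroup.induction_on with
  | H g =>
    rw [MulAction.Quotient.smul_coe, smul_eq_mul, eq_comm, QuotientGroup.eq] at h
    exact hH j a g (by simpa [mul_assoc] using h)

lemma exists_ne_one_smul_eq {H : Subgroup (CoprodI A)} (hH : H ≠ ⊥) (x : CoprodI A ⧸ H) :
    ∃ g : CoprodI A, g ≠ 1 ∧ g • x = x := by
  obtain ⟨h, hh, h1⟩ := (Subgroup.ne_bot_iff_exists_ne_one).1 hH |>.elim
    fun h hne => (⟨h.1, h.2, fun h' => hne (Subtype.ext h')⟩ : ∃ h, h ∈ H ∧ h ≠ 1)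
  induction x using QuotientGroup.induction_on with
  | H g =>
    refine ⟨g * h * g⁻¹, by simpa using h1, ?_⟩
    rw [MulAction.Quotient.smul_coe, smul_eq_mul, inv_mul_cancel_right, eq_comm, QuotientGroup.eq]
    simpa using hh

lemma exists_closure_eq_stabilizer_of_orbit {x y : X} (hxy : y ∈ MulAction.orbit (CoprodI A) x)
    {R : Finset (CoprodI A)}
    (hR : Subgroup.closure (R : Set (CoprodI A)) = MulAction.stabilizer (CoprodI A) x) :
    ∃ R' : Finset (CoprodI A), #R' ≤ #R ∧
      Subgroup.closure (R' : Set (CoprodI A)) = MulAction.stabilizer (CoprodI A) y := by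
  classical
  obtain ⟨g, rfl⟩ := hxy
  refine ⟨R.image (MulAut.conj g), card_image_le, ?_⟩
  simp only [MulAction.stabilizer_smul_eq_stabilizer_map_conj, ← hR, MonoidHom.map_closure,
    coe_image]
  rfl

/-- The quotient by a finitely generated subgroup has a core graph over any finite set of
edges. -/
lemma exists_core {H : Subgroup (CoprodI A)}
    (hH : ∀ (j : J) (a : A j) (g : CoprodI A), g⁻¹ * of a * g ∈ H → a = 1) (hne : H ≠ ⊥)
    {T : Finset (CoprodI A)} (hT : Subgroup.closure (T : Set (CoprodI A)) = H)
    {P : Finset ((CoprodI A ⧸ H) × J)} (hP : P.Nonempty) :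
    ∃ D M : Finset ((CoprodI A ⧸ H) × J), P ⊆ D ∧ Linked A (D : Set ((CoprodI A ⧸ H) × J)) ∧
      Leafless A (M : Set ((CoprodI A ⧸ H) × J)) ∧ 0 ≤ negEuler A M ∧ negEuler A M + 1 ≤ #T ∧
      ∀ E : Set ((CoprodI A ⧸ H) × J), Leafless A E → E ⊆ D → E ⊆ M := by
  have hf := factorsActFreely_quotient hH
  obtain ⟨D, hPD, hD⟩ := exists_linked_superset hT P
  obtain ⟨M, -, hM, -, hML, hmax⟩ := hD.exists_leafless hf (hP.mono hPD)
    fun e _ => exists_ne_one_smul_eq hne e.1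
  refine ⟨D, M, hPD, hD, hML, negEuler_nonneg hf hML, ?_, hmax⟩
  have := card_add_one_le_of_closure_eq hT hM
  unfold negEuler
  omega

/-- The point of `G ⧸ H × G ⧸ K` whose stabilizer is `s⁻¹ H s ⊓ K`. -/
def cosetPair {G : Type*} [Group G] (H K : Subgroup G) (s : G) : (G ⧸ H) × (G ⧸ K) :=
  (((s⁻¹ : G) : G ⧸ H), ((1 : G) : G ⧸ K))

lemma cosetPair_mem_orbit {G : Type*} [Group G] {H K : Subgroup G} {s t : G}
    (h : cosetPair H K t ∈ MulAction.orbit G (cosetPair H K s)) :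
    ∃ a ∈ H, ∃ b ∈ K, t = a * s * b := by
  obtain ⟨g, hg⟩ := h
  obtain ⟨h1, h2⟩ := Prod.ext_iff.1 hg
  simp only [cosetPair, Prod.smul_mk, MulAction.Quotient.smul_coe, smul_eq_mul] at h1 h2
  rw [QuotientGroup.eq] at h1 h2
  refine ⟨t * g * s⁻¹, ?_, g⁻¹, by simpa using h2, by group⟩
  simpa [mul_assoc] using H.inv_mem h1

lemma stabilizer_cosetPair {G : Type*} [Group G] (H K : Subgroup G) (s : G) :
    MulAction.stabilizer G (cosetPair H K s) = conjSubgroup H s ⊓ K := by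
  ext g
  rw [MulAction.mem_stabilizer_iff, Subgroup.mem_inf, cosetPair, Prod.smul_mk, Prod.mk.injEq,
    MulAction.Quotient.smul_coe, MulAction.Quotient.smul_coe, eq_comm, QuotientGroup.eq, eq_comm,
    QuotientGroup.eq]
  refine and_congr ?_ (by simp)
  simp only [conjSubgroup, Subgroup.mem_map]
  constructor
  · intro h
    exact ⟨_, h, by simp [mul_assoc]⟩
  · rintro ⟨h, hh, rfl⟩
    simpa [mul_assoc] using hh

/-- The intersection theorem for subgroups of a free product that meet the conjugates of the
factors trivially, for finitely many double cosets and in terms of generators. -/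
theorem exists_closure_eq_conjSubgroup_inf {u v : ℤ} (hv : 0 < v) (huv : v ≤ u)
    (hL : ∀ (j : J) (L : Subgroup (A j)), Finite L → 3 ≤ Nat.card L →
      v * Nat.card L ≤ u * (Nat.card L - 2))
    {H K : Subgroup (CoprodI A)}
    (hH : ∀ (j : J) (a : A j) (g : CoprodI A), g⁻¹ * of a * g ∈ H → a = 1)
    (hK : ∀ (j : J) (a : A j) (g : CoprodI A), g⁻¹ * of a * g ∈ K → a = 1)
    {T U : Finset (CoprodI A)} (hT : Subgroup.closure (T : Set (CoprodI A)) = H)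
    (hU : Subgroup.closure (U : Set (CoprodI A)) = K) {S : Finset (CoprodI A)}
    (hS : ∀ s ∈ S, ∀ t ∈ S, (∃ a ∈ H, ∃ b ∈ K, t = a * s * b) → s = t) :
    ∃ R : CoprodI A → Finset (CoprodI A),
      (∀ s ∈ S, Subgroup.closure (R s : Set (CoprodI A)) = conjSubgroup H s ⊓ K) ∧
      v * ∑ s ∈ S, ((#(R s) - 1 : ℕ) : ℤ) ≤ 2 * u * (((#T - 1 : ℕ) : ℤ) * ((#U - 1 : ℕ) : ℤ)) := by
  classical
  set z := cosetPair H K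
  have hu : 0 ≤ u := hv.le.trans huv
  set S₁ := S.filter fun s => conjSubgroup H s ⊓ K ≠ ⊥ with hS₁
  rcases S₁.eq_empty_or_nonempty with h0 | ⟨s₀, hs₀⟩
  · refine ⟨fun _ => ∅, fun s hs => ?_, ?_⟩
    · rw [filter_eq_empty_iff] at h0
      have := h0 hs
      rw [not_not] at this
      simp [this]
    · simp only [card_empty, Nat.zero_sub, Nat.cast_zero, sum_const_zero, mul_zero]
      positivity
  have hs₀' := (mem_filter.1 hs₀).2
  have hHne : H ≠ ⊥ := by
    rintro rfl
    apply hs₀'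
    simp [conjSubgroup]
  have hKne : K ≠ ⊥ := by
    rintro rfl
    exact hs₀' (inf_bot_eq _)
  obtain ⟨j₀⟩ : Nonempty J := by
    by_contra hJ
    rw [not_nonempty_iff] at hJ
    apply hKne
    rw [Subgroup.eq_bot_iff_forall]
    exact fun g _ => eq_of_forall_of_mul_eq (q := id) (fun j => hJ.elim j) g
  -- The set `P` forces each base point `z s`, with an edge of index `j₀`, into the fibre product of
  -- `D` and `E`.
  obtain ⟨D, M, hPD, hD, hM, hM0, hMT, hMmax⟩ := exists_core hH hHne hT
    (P := S₁.image fun s => ((z s).1, j₀)) ⟨_, mem_image_of_mem _ hs₀⟩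
  obtain ⟨E, N, hPE, hE, hN, hN0, hNU, hNmax⟩ := exists_core hK hKne hU
    (P := {(((1 : CoprodI A) : CoprodI A ⧸ K), j₀)}) (singleton_nonempty _)
  have hfH := factorsActFreely_quotient hH
  have hfK := factorsActFreely_quotient hK
  have hf : FactorsActFreely A ((CoprodI A ⧸ H) × (CoprodI A ⧸ K)) :=
    fun j a x h => hfH j a x.1 (congrArg Prod.fst h)
  have hC : ∀ s : CoprodI A, ∃ C : Finset (((CoprodI A ⧸ H) × (CoprodI A ⧸ K)) × J), s ∈ S₁ →
      Leafless A (C : Set (((CoprodI A ⧸ H) × (CoprodI A ⧸ K)) × J)) ∧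
      (C : Set (((CoprodI A ⧸ H) × (CoprodI A ⧸ K)) × J)) ⊆ fiberProd (M : Set ((CoprodI A ⧸ H) × J))
        (N : Set ((CoprodI A ⧸ K) × J)) ∧
      (∀ e ∈ C, e.1 ∈ MulAction.orbit (CoprodI A) (z s)) ∧
      ∃ R : Finset (CoprodI A), Subgroup.closure (R : Set (CoprodI A)) = conjSubgroup H s ⊓ K ∧
        (#R : ℤ) ≤ negEuler A C + 1 := by
    intro s
    by_cases hs : s ∈ S₁
    swap
    · exact ⟨∅, fun h => absurd h hs⟩
    have hsne := (mem_filter.1 hs).2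
    have hlk := linked_fiberProd_orbit hD hE (z s)
    have hfin : {e ∈ fiberProd (D : Set ((CoprodI A ⧸ H) × J)) (E : Set ((CoprodI A ⧸ K) × J)) |
        e.1 ∈ MulAction.orbit (CoprodI A) (z s)}.Finite :=
      (finite_fiberProd D E).subset (Set.sep_subset _ _)
    rw [← hfin.coe_toFinset] at hlk
    obtain ⟨C, hCsub, ⟨e₀, he₀⟩, hClk, hC, -⟩ := hlk.exists_leafless hf
      ⟨(z s, j₀), by
        rw [Set.Finite.mem_toFinset]
        exact ⟨⟨hPD (mem_image_of_mem _ hs), hPE (mem_singleton_self _)⟩, MulAction.mem_orbit_self _⟩⟩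
      (by
        intro e he
        rw [Set.Finite.mem_toFinset] at he
        obtain ⟨g, hg⟩ := he.2
        rw [← stabilizer_cosetPair, Ne, Subgroup.eq_bot_iff_forall] at hsne
        push Not at hsne
        obtain ⟨l, hl, hl1⟩ := hsne
        refine ⟨g * l * g⁻¹, by simpa using hl1, ?_⟩
        rw [MulAction.mem_stabilizer_iff] at hl
        simp only at hg
        rw [← hg, mul_smul, mul_smul, inv_smul_smul, hl])
    have hCD : ∀ e ∈ C, e ∈ fiberProd (D : Set ((CoprodI A ⧸ H) × J)) (E : Set ((CoprodI A ⧸ K) × J)) ∧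
        e.1 ∈ MulAction.orbit (CoprodI A) (z s) := fun e he => by
      have := hCsub he
      rw [Set.Finite.mem_toFinset] at this
      exact this
    -- The projection of `C` is a leafless part of `D`, hence lies in its maximal leafless part `M`.
    have hCM := hMmax _ (hC.map (Prod.fst : (CoprodI A ⧸ H) × (CoprodI A ⧸ K) → _) fun _ _ => rfl) (by
      rintro ⟨x, j⟩ ⟨⟨x', y⟩, rfl, h⟩
      exact (hCD _ h).1.1)
    have hCN := hNmax _ (hC.map (Prod.snd : (CoprodI A ⧸ H) × (CoprodI A ⧸ K) → _) fun _ _ => rfl) (by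
      rintro ⟨x, j⟩ ⟨⟨x', y⟩, rfl, h⟩
      exact (hCD _ h).1.2)
    refine ⟨C, fun _ => ⟨hC, ?_, fun e he => (hCD e he).2, ?_⟩⟩
    · rintro ⟨⟨x, y⟩, j⟩ h
      exact ⟨hCM ⟨_, rfl, h⟩, hCN ⟨_, rfl, h⟩⟩
    · have horb : ∀ x ∈ points C, ∃ g : CoprodI A, g • e₀.1 = x := by
        intro x hx
        obtain ⟨j, hj⟩ := mem_points.1 hx
        have h1 := MulAction.orbit_eq_iff.2 (hCD _ he₀).2
        have h2 := (hCD _ hj).2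
        rw [← h1] at h2
        exact h2
      obtain ⟨R, hR, hRc⟩ := hClk.exists_closure_eq_stabilizer hf (fst_mem_points he₀) horb
      -- Pruning may have removed `z s`; the stabilizer of the surviving point `e₀.1` of the same
      -- orbit is conjugated back.
      obtain ⟨R', hR'c, hR'⟩ := exists_closure_eq_stabilizer_of_orbit
        (MulAction.mem_orbit_symm.1 (hCD _ he₀).2) hR
      refine ⟨R', by rw [hR']; exact stabilizer_cosetPair H K s, ?_⟩
      unfold negEuler
      omega
  choose C hC using hC
  have hR : ∀ s : CoprodI A, ∃ R : Finset (CoprodI A), s ∈ S →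
      Subgroup.closure (R : Set (CoprodI A)) = conjSubgroup H s ⊓ K ∧
      (s ∈ S₁ → (#R : ℤ) ≤ negEuler A (C s) + 1) ∧ (s ∉ S₁ → #R = 0) := by
    intro s
    by_cases hs : s ∈ S₁
    · obtain ⟨R, h1, h2⟩ := (hC s hs).2.2.2
      exact ⟨R, fun _ => ⟨h1, fun _ => h2, fun h => absurd hs h⟩⟩
    · refine ⟨∅, fun hsS => ⟨?_, fun h => absurd h hs, fun _ => rfl⟩⟩
      have : conjSubgroup H s ⊓ K = ⊥ := by
        by_contra h
        exact hs (mem_filter.2 ⟨hsS, h⟩)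
      simp [this]
  choose R hR using hR
  refine ⟨R, fun s hs => (hR s hs).1, ?_⟩
  have hsum : ∑ s ∈ S, ((#(R s) - 1 : ℕ) : ℤ) ≤ ∑ s ∈ S₁, negEuler A (C s) := by
    rw [← sum_subset (filter_subset _ S : S₁ ⊆ S)]
    · apply sum_le_sum
      intro s hs
      have h1 := (hR s (mem_filter.1 hs).1).2.1 hs
      have h2 := negEuler_nonneg hf (hC s hs).1
      omega
    · intro s hs hs'
      rw [(hR s hs).2.2 hs']
      rfl
  -- Inequivalent `s` give different orbits, so the graphs `C s` are disjoint and are estimated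
  -- together as one graph.
  rw [← negEuler_biUnion] at hsum
  · have hmain := negEuler_le hv huv hL hfH hfK hM hN (C := S₁.biUnion C) (by
      intro e he
      rw [mem_coe, mem_biUnion] at he
      obtain ⟨s, hs, he⟩ := he
      exact (hC s hs).2.1 he)
    have h1 : negEuler A M ≤ ((#T - 1 : ℕ) : ℤ) := by omega
    have h2 : negEuler A N ≤ ((#U - 1 : ℕ) : ℤ) := by omega
    have h3 := mul_le_mul h1 h2 hN0 (by positivity)
    have h4 := mul_le_mul_of_nonneg_left h3 (by positivity : 0 ≤ 2 * u)
    have h5 := mul_le_mul_of_nonneg_left hsum hv.le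
    linarith
  · intro s hs t ht hst e he f hf' horb
    apply hst
    apply hS s (mem_filter.1 hs).1 t (mem_filter.1 ht).1
    apply cosetPair_mem_orbit
    have h1 := MulAction.orbit_eq_iff.2 ((hC s hs).2.2.1 e he)
    have h2 := MulAction.orbit_eq_iff.2 ((hC t ht).2.2.1 f hf')
    have h3 := MulAction.orbit_eq_iff.2 horb
    rw [← MulAction.orbit_eq_iff, ← h2, h3, h1]

end Intersection

end FreeProductRank

namespace FreeProductRank

open Monoid Finset

/-! ### Ranks, reduced ranks and the constant `theta`. -/

section Rank

variable {G : Type*} [Group G]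

lemma rank_le_card {L : Subgroup G} {R : Finset G}
    (hR : Subgroup.closure (R : Set G) = L) : rank L ≤ #R := by
  subst hR
  refine (iInf₂_le (f := fun (S : Set (Subgroup.closure (R : Set G))) (_ : Subgroup.closure S = ⊤) =>
    S.encard) _ (Subgroup.closure_closure_coe_preimage (k := (R : Set G)))).trans ?_
  rw [← Set.encard_coe_eq_coe_finsetCard]
  exact (Subtype.val_injective.encard_image _).symm.trans_le
    (Set.encard_le_encard (Set.image_preimage_subset _ _))

lemma exists_closure_eq_card_le_rank {L : Subgroup G} (hL : L.FG) :
    ∃ R : Finset G, Subgroup.closure (R : Set G) = L ∧ (#R : ℕ∞) ≤ rank L := by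
  classical
  obtain ⟨n, ⟨S, hS, rfl⟩, hmin⟩ := WellFounded.has_min (wellFounded_lt (α := ℕ∞))
    {n | ∃ S : Set L, Subgroup.closure S = ⊤ ∧ S.encard = n} ⟨_, Set.univ, Subgroup.closure_univ, rfl⟩
  have hle : S.encard ≤ rank L :=
    le_iInf₂ fun S' hS' => not_lt.1 (hmin _ ⟨S', hS', rfl⟩)
  obtain ⟨R₀, hR₀⟩ := hL
  have hfin : S.Finite := by
    rw [← Set.encard_lt_top_iff]
    by_contra h
    have h1 := rank_le_card hR₀
    have h2 : (#R₀ : ℕ∞) < ⊤ := ENat.natCast_lt_top _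
    exact h (hle.trans_lt (h1.trans_lt h2))
  refine ⟨hfin.toFinset.image L.subtype, ?_, ?_⟩
  · rw [coe_image, Set.Finite.coe_toFinset, ← MonoidHom.map_closure, hS,
      ← MonoidHom.range_eq_map, Subgroup.range_subtype]
  · refine le_trans ?_ hle
    rw [hfin.encard_eq_coe_toFinset_card]
    exact_mod_cast card_image_le

lemma reducedRank_le {n : ℕ} (h : rank G ≤ n) : reducedRank G ≤ ((n - 1 : ℕ) : ℝ≥0∞) := by
  have h1 : rank G - 1 ≤ ((n - 1 : ℕ) : ℕ∞) := by
    rw [ENat.natCast_sub, Nat.cast_one]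
    exact tsub_le_tsub_right h 1
  rw [reducedRank, ← ENat.toENNReal_coe]
  exact ENat.toENNReal_le.2 h1

lemma le_reducedRank {n : ℕ} (h : (n : ℕ∞) ≤ rank G) : ((n - 1 : ℕ) : ℝ≥0∞) ≤ reducedRank G := by
  have h1 : ((n - 1 : ℕ) : ℕ∞) ≤ rank G - 1 := by
    rw [ENat.natCast_sub, Nat.cast_one]
    exact tsub_le_tsub_right h 1
  rw [reducedRank, ← ENat.toENNReal_coe]
  exact ENat.toENNReal_le.2 h1

lemma three_le_height : 3 ≤ height G := le_iInf₂ fun _ h => h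

lemma height_le {Γ : Type*} [Group Γ] {f : Γ →* G} (hf : Function.Injective f) {L : Subgroup Γ}
    [Finite L] (hL : 3 ≤ Nat.card L) : height G ≤ Nat.card L := by
  have h : ((L.map f : Subgroup G) : Set G).encard = Nat.card L := by
    rw [Subgroup.coe_map, hf.encard_image, Set.encard, ENat.card_eq_coe_natCard]
    rfl
  rw [← h]
  exact iInf₂_le (L.map f) (by rw [h]; exact_mod_cast hL)

/-- The ratio `theta (height G)` as a quotient of integers. -/
lemma exists_theta_height_eq : ∃ u v : ℕ, 0 < v ∧ v ≤ u ∧ theta (height G) = (u : ℝ≥0∞) / v ∧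
    ∀ n : ℕ, height G ≤ n → (v : ℤ) * n ≤ u * (n - 2) := by
  rcases eq_or_ne (height G) ⊤ with h | h
  · refine ⟨1, 1, one_pos, le_rfl, by simp [theta, h], fun n hn => ?_⟩
    rw [h, top_le_iff] at hn
    exact absurd hn (ENat.natCast_ne_top n)
  · obtain ⟨p, hp⟩ := ENat.ne_top_iff_exists.1 h
    have h3 := three_le_height (G := G)
    rw [← hp] at h3 ⊢
    have h3 : 3 ≤ p := by exact_mod_cast h3
    -- With `u = p` and `v = p - 2`, the inequality `v * n ≤ u * (n - 2)` reduces to `p ≤ n`.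
    refine ⟨p, p - 2, by omega, by omega, ?_, fun n hn => ?_⟩
    · simp [theta]
    · have hn : p ≤ n := by exact_mod_cast hn
      rw [Nat.cast_sub (by omega)]
      have : (p : ℤ) ≤ n := by exact_mod_cast hn
      push_cast
      linarith

end Rank

/-! ### Replacing the free factor by infinite cyclic factors. -/

section Embedding

universe u₁ u₂ u₃

variable {I : Type u₁} (F : Type u₂) [Group F] [IsFreeGroup F] (A : I → Type u₃)
  [∀ i, Group (A i)]

/-- The factors `A i` together with two infinite cyclic groups for each free generator of `F`. -/
def Factor : I ⊕ (IsFreeGroup.Generators F ⊕ IsFreeGroup.Generators F) → Type u₃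
  | .inl i => A i
  | .inr _ => ULift (Multiplicative ℤ)

instance : ∀ j, Group (Factor F A j)
  | .inl i => inferInstanceAs (Group (A i))
  | .inr _ => inferInstanceAs (Group (ULift (Multiplicative ℤ)))

variable {F} in
/-- The inclusion of the factor `A i`. -/
def ofLeft (i : I) : A i →* CoprodI (Factor F A) :=
  CoprodI.of (M := Factor F A) (i := .inl i)

variable {F} in
/-- The inclusion of an infinite cyclic factor. -/
def ofRight (y : IsFreeGroup.Generators F ⊕ IsFreeGroup.Generators F) :
    ULift.{u₃} (Multiplicative ℤ) →* CoprodI (Factor F A) :=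
  CoprodI.of (M := Factor F A) (i := .inr y)

/-- The generator of an infinite cyclic factor. -/
def cyclicGen (y : IsFreeGroup.Generators F ⊕ IsFreeGroup.Generators F) :
    CoprodI (Factor F A) :=
  ofRight A y (ULift.up (Multiplicative.ofAdd 1))

/-- The embedding of `F * A` into a free product of the `A i` and of infinite cyclic groups, which
sends a free generator of `F` to the product of the generators of two cyclic factors. -/
noncomputable def embed : FreeProd F A →* CoprodI (Factor F A) :=
  Coprod.lift (IsFreeGroup.lift fun x => cyclicGen F A (.inl x) * cyclicGen F A (.inr x))
    (CoprodI.lift (ofLeft A))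

variable {F A}

/-- The restrictions of `retract` to the factors. -/
def retractAux (b : IsFreeGroup.Generators F ⊕ IsFreeGroup.Generators F → FreeProd F A) :
    ∀ j, Factor F A j →* FreeProd F A
  | .inl i => ((Coprod.inr : CoprodI A →* FreeProd F A).comp CoprodI.of : A i →* FreeProd F A)
  | .inr y => ((zpowersHom _ (b y)).comp (MulEquiv.ulift : ULift (Multiplicative ℤ) ≃* _).toMonoidHom :
      ULift (Multiplicative ℤ) →* FreeProd F A)

/-- The homomorphism that sends the generators of the cyclic factors to given elements and is the
identity on the `A i`. -/
def retract (b : IsFreeGroup.Generators F ⊕ IsFreeGroup.Generators F → FreeProd F A) :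
    CoprodI (Factor F A) →* FreeProd F A :=
  CoprodI.lift (retractAux b)

lemma retract_ofLeft (b : IsFreeGroup.Generators F ⊕ IsFreeGroup.Generators F → FreeProd F A)
    {i : I} (a : A i) : retract b (ofLeft A i a) = Coprod.inr (CoprodI.of a) :=
  CoprodI.lift_of (retractAux b) (i := .inl i) a

lemma retract_ofRight (b : IsFreeGroup.Generators F ⊕ IsFreeGroup.Generators F → FreeProd F A)
    {y : IsFreeGroup.Generators F ⊕ IsFreeGroup.Generators F} (a : ULift.{u₃} (Multiplicative ℤ)) :
    retract b (ofRight A y a) = b y ^ (a.down.toAdd) :=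
  CoprodI.lift_of (retractAux b) (i := .inr y) a

lemma retract_cyclicGen (b : IsFreeGroup.Generators F ⊕ IsFreeGroup.Generators F → FreeProd F A)
    (y : IsFreeGroup.Generators F ⊕ IsFreeGroup.Generators F) :
    retract b (cyclicGen F A y) = b y := by
  rw [cyclicGen, retract_ofRight]
  simp

lemma retract_embed {b : IsFreeGroup.Generators F ⊕ IsFreeGroup.Generators F → FreeProd F A}
    (hb : ∀ x, b (.inl x) * b (.inr x) = Coprod.inl (IsFreeGroup.of x)) (g : FreeProd F A) :
    retract b (embed F A g) = g := by
  have h : (retract b).comp (embed F A) = MonoidHom.id _ := by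
    apply Coprod.hom_ext
    · apply IsFreeGroup.ext_hom
      intro x
      simp [embed, retract_cyclicGen, hb]
    · apply CoprodI.ext_hom
      intro i
      ext a
      simp only [embed, MonoidHom.comp_apply, Coprod.lift_apply_inr, CoprodI.lift_of,
        retract_ofLeft, MonoidHom.id_apply]
  exact DFunLike.congr_fun h g

/-- The retraction that kills the second cyclic factor of each free generator. -/
noncomputable def retractFst : CoprodI (Factor F A) →* FreeProd F A :=
  retract (Sum.elim (fun x => Coprod.inl (IsFreeGroup.of x)) 1)

lemma retractFst_embed (g : FreeProd F A) : retractFst (embed F A g) = g :=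
  retract_embed (by simp) g

lemma embed_injective : Function.Injective (embed F A) :=
  Function.LeftInverse.injective retractFst_embed

/-- Any splitting `b` of the free generators gives a retraction onto `F * A`. For a factor `A i` the
retraction carries the element into a conjugate of `A i`, which `H` meets trivially. For a cyclic
factor it can be chosen to kill that factor, and with it the element of `H`. -/
lemma eq_one_of_conj_mem_map_embed {H : Subgroup (FreeProd F A)} (hH : H ∈ freeFamily F A)
    (j : I ⊕ (IsFreeGroup.Generators F ⊕ IsFreeGroup.Generators F)) (a : Factor F A j)
    (g : CoprodI (Factor F A)) (h : g⁻¹ * CoprodI.of a * g ∈ H.map (embed F A)) : a = 1 := by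
  obtain ⟨k, hk, hkg⟩ := h
  suffices k = 1 by
    rw [this, map_one, eq_comm, mul_assoc, inv_mul_eq_one, eq_comm, mul_eq_right] at hkg
    exact CoprodI.of_injective j (by rw [hkg, map_one])
  have key : ∀ b : IsFreeGroup.Generators F ⊕ IsFreeGroup.Generators F → FreeProd F A,
      (∀ x, b (.inl x) * b (.inr x) = Coprod.inl (IsFreeGroup.of x)) →
      k = (retract b g)⁻¹ * retract b (CoprodI.of a) * retract b g := by
    intro b hb
    rw [← retract_embed hb k, hkg, map_mul, map_mul, map_inv]
  have key' : ∀ b : IsFreeGroup.Generators F ⊕ IsFreeGroup.Generators F → FreeProd F A,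
      (∀ x, b (.inl x) * b (.inr x) = Coprod.inl (IsFreeGroup.of x)) →
      ∀ c, retract b (CoprodI.of a) = c → k = (retract b g)⁻¹ * c * retract b g :=
    fun b hb c hc => hc ▸ key b hb
  match j, a, key' with
  | .inl i, a, key' =>
    have h1 := key' (Sum.elim (fun x => Coprod.inl (IsFreeGroup.of x)) 1) (by simp) _
      (retract_ofLeft (A := A) (i := i) _ a)
    have h2 : k ∈ H ⊓ conjSubgroup (factor F A i) _ := ⟨hk, _, ⟨a, rfl⟩, by
      rw [h1]; simp; rfl⟩
    rw [hH.2] at h2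
    exact Subgroup.mem_bot.1 h2
  | .inr (.inl x), a, key' =>
    simpa using key' (Sum.elim 1 (fun x => Coprod.inl (IsFreeGroup.of x))) (by simp) _
      (retract_ofRight _ a)
  | .inr (.inr x), a, key' =>
    simpa using key' (Sum.elim (fun x => Coprod.inl (IsFreeGroup.of x)) 1) (by simp) _
      (retract_ofRight _ a)

lemma card_le_one_of_finite (L : Subgroup (ULift.{u₃} (Multiplicative ℤ))) [Finite L] :
    Nat.card L ≤ 1 := by
  rw [Finite.card_le_one_iff_subsingleton]
  have h1 : ∀ a : L, a = 1 := by
    intro a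
    obtain ⟨n, hn, h3⟩ := isOfFinOrder_iff_pow_eq_one.1 (isOfFinOrder_of_finite a)
    have h4 : a.1.down ^ n = 1 := congrArg (fun c : L => c.1.down) h3
    refine Subtype.ext (ULift.ext _ _ ?_)
    change a.1.down = 1
    rw [← toAdd_eq_zero] at h4 ⊢
    rw [toAdd_pow] at h4
    exact (smul_eq_zero.1 h4).resolve_left hn.ne'
  exact ⟨fun a b => by rw [h1 a, h1 b]⟩

/-- The added cyclic factors are torsion-free, so a finite subgroup of order at least three lies in
some `A i`, which embeds in the original group. Thus the constant does not deteriorate. -/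
lemma height_le_of_factor (j : I ⊕ (IsFreeGroup.Generators F ⊕ IsFreeGroup.Generators F))
    (L : Subgroup (Factor F A j)) (hfin : Finite L) (hL : 3 ≤ Nat.card L) :
    height (FreeProd F A) ≤ Nat.card L := by
  match j, L, hfin, hL with
  | .inl i, L, hfin, hL =>
    have hf : Function.Injective ((Coprod.inr : CoprodI A →* FreeProd F A).comp
        (CoprodI.of : A i →* CoprodI A)) :=
      Coprod.inr_injective.comp (CoprodI.of_injective i)
    exact @height_le _ _ (A i) _ _ hf L hfin hL
  | .inr y, L, hfin, hL =>
    exact absurd (hL.trans (@card_le_one_of_finite L hfin)) (by norm_num)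

lemma conjSubgroup_map {G G' : Type*} [Group G] [Group G'] (f : G →* G') (H : Subgroup G) (s : G) :
    conjSubgroup (H.map f) (f s) = (conjSubgroup H s).map f := by
  unfold conjSubgroup
  rw [Subgroup.map_map, Subgroup.map_map]
  congr 1
  ext g
  simp

end Embedding

/-- The bound for the reduced ranks of the intersections of two subgroups in `freeFamily F A`. -/
theorem tsum_reducedRank_conjSubgroup_inf_le {I : Type*} (F : Type*) [Group F] [IsFreeGroup F]
    (A : I → Type*) [∀ i, Group (A i)]
    (H K : Subgroup (FreeProd F A))
    (hH : H ∈ freeFamily F A) (hK : K ∈ freeFamily F A)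
    (S : Set (FreeProd F A))
    (hS : IsDoubleCosetReps H K S) :
    ∑' s : S, reducedRank
        ↥(conjSubgroup H (s : FreeProd F A) ⊓ K) ≤
      2 * theta (height (FreeProd F A)) *
        reducedRank H * reducedRank K := by
  classical
  obtain ⟨T, hT, hTr⟩ := exists_closure_eq_card_le_rank hH.1
  obtain ⟨U, hU, hUr⟩ := exists_closure_eq_card_le_rank hK.1
  obtain ⟨u, v, hv, huv, hθ, hn⟩ := exists_theta_height_eq (G := FreeProd F A)
  have himage : ∀ {L : Subgroup (FreeProd F A)} {T : Finset (FreeProd F A)},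
      Subgroup.closure (T : Set (FreeProd F A)) = L →
      Subgroup.closure ((T.image (embed F A) : Finset _) : Set _) = L.map (embed F A) := by
    intro L T h
    rw [Finset.coe_image, ← MonoidHom.map_closure, h]
  rw [ENNReal.tsum_eq_iSup_sum]
  refine iSup_le fun S₀ => ?_
  obtain ⟨R, hR, hsum⟩ := exists_closure_eq_conjSubgroup_inf (u := u) (v := v)
    (by exact_mod_cast hv) (by exact_mod_cast huv)
    (fun j L hfin hL => hn _ (height_le_of_factor j L hfin hL))
    (eq_one_of_conj_mem_map_embed hH) (eq_one_of_conj_mem_map_embed hK) (himage hT) (himage hU)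
    (S := S₀.image fun s : S => embed F A s.1) (by
      intro s' hs' t' ht' h
      obtain ⟨s, -, rfl⟩ := Finset.mem_image.1 hs'
      obtain ⟨t, -, rfl⟩ := Finset.mem_image.1 ht'
      obtain ⟨_, ⟨a, ha, rfl⟩, _, ⟨b, hb, rfl⟩, h⟩ := h
      rw [← map_mul, ← map_mul] at h
      have h1 := embed_injective h
      obtain ⟨r, -, hr⟩ := hS s
      have e1 := hr s ⟨s.2, DoubleCoset.mem_doubleCoset.2 ⟨1, H.one_mem, 1, K.one_mem, by simp⟩⟩
      have e2 := hr t ⟨t.2, DoubleCoset.mem_doubleCoset.2 ⟨a, ha, b, hb, h1⟩⟩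
      rw [e1, e2])
  rw [Finset.sum_image fun s _ t _ h => Subtype.ext (embed_injective h)] at hsum
  have hrank : ∀ s ∈ S₀, reducedRank ↥(conjSubgroup H (s : FreeProd F A) ⊓ K) ≤
      (((R (embed F A s.1)).card - 1 : ℕ) : ℝ≥0∞) := by
    intro s hs
    have h1 := hR _ (Finset.mem_image_of_mem _ hs)
    rw [conjSubgroup_map, ← Subgroup.map_inf _ _ _ embed_injective] at h1
    -- The generators found in the larger free product are carried back by the retraction, which
    -- does not increase their number.
    have h2 : Subgroup.closure (((R (embed F A s.1)).image retractFst : Finset (FreeProd F A)) :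
        Set (FreeProd F A)) = conjSubgroup H (s : FreeProd F A) ⊓ K := by
      rw [Finset.coe_image, ← MonoidHom.map_closure, h1, Subgroup.map_map,
        show (retractFst.comp (embed F A)) = MonoidHom.id _ from MonoidHom.ext retractFst_embed,
        Subgroup.map_id]
    refine reducedRank_le ((rank_le_card h2).trans ?_)
    exact_mod_cast Finset.card_image_le
  refine (Finset.sum_le_sum hrank).trans ?_
  have hTU : ((2 * u * ((T.card - 1) * (U.card - 1)) : ℕ) : ℝ≥0∞) / v ≤
      2 * theta (height (FreeProd F A)) * reducedRank H * reducedRank K := by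
    rw [hθ]
    push_cast
    have h1 := le_reducedRank hTr
    have h2 := le_reducedRank hUr
    calc _ = 2 * ((u : ℝ≥0∞) / v) * ((T.card - 1 : ℕ) : ℝ≥0∞) * ((U.card - 1 : ℕ) : ℝ≥0∞) := by
          push_cast; simp only [div_eq_mul_inv]; ring
      _ ≤ _ := by gcongr
  refine le_trans ?_ hTU
  rw [ENNReal.le_div_iff_mul_le (by simp [hv.ne']) (by simp), mul_comm]
  have h3 : v * ∑ s ∈ S₀, ((R (embed F A s.1)).card - 1) ≤
      2 * u * (((T.image (embed F A)).card - 1) * ((U.image (embed F A)).card - 1)) := by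
    exact_mod_cast hsum
  have h4 := h3.trans (Nat.mul_le_mul_left (2 * u) (Nat.mul_le_mul
    (Nat.sub_le_sub_right (Finset.card_image_le (s := T) (f := embed F A)) 1)
    (Nat.sub_le_sub_right (Finset.card_image_le (s := U) (f := embed F A)) 1)))
  exact_mod_cast h4

end FreeProductRank

theorem theorem5 {I : Type*} (F : Type*) [Group F] [IsFreeGroup F]
    (A : I → Type*) [∀ i, Group (A i)]
    (H K : Subgroup (FreeProductRank.FreeProd F A))
    (hH : H ∈ FreeProductRank.freeFamily F A) (hK : K ∈ FreeProductRank.freeFamily F A)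
    (S : Set (FreeProductRank.FreeProd F A))
    (hS : FreeProductRank.IsDoubleCosetReps H K S) :
    ∑' s : S, FreeProductRank.reducedRank
        ↥(FreeProductRank.conjSubgroup H (s : FreeProductRank.FreeProd F A) ⊓ K) ≤
      2 * FreeProductRank.theta (FreeProductRank.height (FreeProductRank.FreeProd F A)) *
        FreeProductRank.reducedRank H * FreeProductRank.reducedRank K :=
  FreeProductRank.tsum_reducedRank_conjSubgroup_inf_le F A H K hH hK S hS
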